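/- Let $d\ge 1$, let $\Omega\subset\mathbb R^d$ be a bounded open set, $\nu>0$, $T>0$, and let functions on $\Omega$ take values in a finite-dimensional real inner product space (for instance $\mathbb R$ or $\mathbb R^d$). Write $L^2=L^2(\Omega)$ and let $X=H^1_0(\Omega)$ be the $H^1$-closure of $C_c^\infty(\Omega)$, with inner product $(v,w)_{H^1_0}=(\nabla v,\nabla w)_{L^2}$. Then there is a constant $C>0$, depending only on $\Omega$, $\nu$, $T$ and the space of values (hence independent of $u$, $f$, $N$, $\Delta t$, $r$ and of the POD basis), such that the following holds. Let $u\in C([0,T];L^2)$, with $u(t)\in X$ for all $t\in[0,T]$, be a weak solution of the heat equation, i.e. for almost every $t\in(0,T)$ $$(\partial_t u,v)_{L^2}+\nu(\nabla u,\nabla v)_{L^2}=(f,v)_{L^2}\qquad\forall v\in X,$$ and assume that $u_{ttt},\ \Delta u_{tt},\ f_{tt}\in L^2(0,T;L^2)$ (weak derivatives; the lower time derivatives of $u$ and $f$ are then also in $L^2(0,T;L^2)$, and $f$ denotes the representative that is continuous on $[0,T]$). Put $$I(u,f)=\|u_{ttt}\|^2_{L^2(0,T;L^2)}+\|\Delta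 u_{tt}\|^2_{L^2(0,T;L^2)}+\|f_{tt}\|^2_{L^2(0,T;L^2)}.$$ *POD with difference quotients.* Let $N\ge1$, $\Delta t=T/N$, $t_n=n\Delta t$, $u^n=u(t_n)$, and let $v^n=u^n$ for $0\le n\le N$ and $v^{N+n}=\partial u^n=(u^n-u^{n-1})/\Delta t$ for $1\le n\le N$. Let $\mathcal H=L^2$ ("$L^2$ POD basis") or $\mathcal H=H^1_0$ ("$H^1_0$ POD basis"). Let $\lambda_1^{DQ}\ge\lambda_2^{DQ}\ge\dots\ge\lambda_{2N+1}^{DQ}\ge0$ be the eigenvalues, with corresponding orthonormal eigenvectors $\mathbf z_i$, of the matrix $K_{mn}=\frac1{2N+1}(v^m,v^n)_{\mathcal H}$, $0\le m,n\le 2N$; let $s$ be the number of positive eigenvalues and, for $1\le i\le s$, $\varphi_i=(\lambda_i^{DQ})^{-1/2}(2N+1)^{-1/2}\sum_{m=0}^{2N}(\mathbf z_i)^m v^m$. Let $0\le r\le s$, $X^r=\mathrm{span}\{\varphi_1,\dots,\varphi_r\}\subset X$, and let $R_r:X\to X^r$ be the Ritz projection, $(\nabla(w-R_rw),\nabla v_r)_{L^2}=0$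 for all $v_r\in X^r$. *Crank–Nicolson POD-Galerkin ROM.* Let $u_r^0,\dots,u_r^N\in X^r$ satisfy, for $0\le n\le N-1$, $$\Big(\frac{u_r^{n+1}-u_r^n}{\Delta t},v_r\Big)_{L^2}+\nu(\nabla u_r^{n+1/2},\nabla v_r)_{L^2}=(f^{n+1/2},v_r)_{L^2}\qquad\forall v_r\in X^r,$$ where $z^{n+1/2}=\frac12(z^{n+1}+z^n)$ and $f^n=f(t_n)$; the initial value $u_r^0\in X^r$ is arbitrary. Let $e^n=u^n-u_r^n$ and $\phi_r^0=u_r^0-R_ru^0$. If the $L^2$ POD basis is used, then $$\max_{1\le k\le N}\|e^k\|_{L^2}^2\le C\Big(\sum_{i=r+1}^s\lambda_i^{DQ}\|\varphi_i-R_r\varphi_i\|_{L^2}^2+\|\phi_r^0\|_{L^2}^2+\Delta t^4I(u,f)\Big),$$ $$\|e^N\|_{L^2}^2+\Delta t\sum_{n=0}^{N-1}\|\nabla e^{n+1/2}\|_{L^2}^2\le C\Big(\sum_{i=r+1}^s\lambda_i^{DQ}\big(\|\varphi_i-R_r\varphi_i\|_{L^2}^2+\|\nabla(\varphi_i-R_r\varphi_i)\|_{L^2}^2\big)+\|\phi_r^0\|_{L^2}^2+\Delta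 t^4I(u,f)\Big).$$ If the $H^1_0$ POD basis is used, then $$\max_{1\le k\le N}\|e^k\|_{L^2}^2\le C\Big(\sum_{i=r+1}^s\lambda_i^{DQ}\|\varphi_i\|_{L^2}^2+\|\phi_r^0\|_{L^2}^2+\Delta t^4I(u,f)\Big),$$ $$\|e^N\|_{L^2}^2+\Delta t\sum_{n=0}^{N-1}\|\nabla e^{n+1/2}\|_{L^2}^2\le C\Big(\sum_{i=r+1}^s(1+\|\varphi_i\|_{L^2}^2)\lambda_i^{DQ}+\|\phi_r^0\|_{L^2}^2+\Delta t^4I(u,f)\Big).$$ -/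

import Mathlib

open MeasureTheory Set Filter
open scoped ContDiff

noncomputable section

namespace PODHeat

/-! ## Function spaces on an open set `Ω ⊆ ℝᵈ`

Functions take values in a finite-dimensional inner product space `F`
(`F = ℝ` for the scalar heat equation, `F = ℝᵈ` for the vector-valued one). -/

/-- Test functions: smooth, with compact support contained in `Ω`. -/
def IsTest {E G : Type*} [NormedAddCommGroup E] [NormedSpace ℝ E]
    [NormedAddCommGroup G] [NormedSpace ℝ G] (Ω : Set E) (φ : E → G) : Prop :=
  ContDiff ℝ ∞ φ ∧ HasCompactSupport φ ∧ tsupport φ ⊆ Ω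

/-- The `j`-th partial derivative of a function on `ℝᵈ`. -/
def partialDeriv {d : ℕ} {G : Type*} [NormedAddCommGroup G] [NormedSpace ℝ G]
    (j : Fin d) (φ : EuclideanSpace ℝ (Fin d) → G) (x : EuclideanSpace ℝ (Fin d)) : G :=
  fderiv ℝ φ x (EuclideanSpace.single j 1)

section Spaces

variable {d : ℕ} (Ω : Set (EuclideanSpace ℝ (Fin d)))
variable (F : Type*) [NormedAddCommGroup F] [InnerProductSpace ℝ F]

/-- `L²(Ω; F)`. -/
abbrev L2 : Type _ := Lp F 2 (volume.restrict Ω)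

/-- The space of gradients, `L²(Ω; F)ᵈ` with the Hilbert norm `‖G‖² = ∑ⱼ ‖Gⱼ‖²`. -/
abbrev Grad : Type _ := PiLp 2 (fun _ : Fin d => L2 Ω F)

/-- The pairs `(φ, ∇φ)` for `φ ∈ C_c^∞(Ω; F)`, as elements of `L² × (L²)ᵈ`. -/
def testPairs : Set (WithLp 2 (L2 Ω F × Grad Ω F)) :=
  {p | ∃ φ : EuclideanSpace ℝ (Fin d) → F, IsTest Ω φ ∧
    (p.fst : EuclideanSpace ℝ (Fin d) → F) =ᵐ[volume.restrict Ω] φ ∧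
    ∀ j, (p.snd j : EuclideanSpace ℝ (Fin d) → F) =ᵐ[volume.restrict Ω] partialDeriv j φ}

/-- `H¹₀(Ω; F)`, the closure of `C_c^∞(Ω; F)` in the `H¹` norm. Its elements are stored as pairs
`(w, ∇w)`: the map `w ↦ (w, ∇w)` is an isometry of `H¹` into `L² × (L²)ᵈ` with the Hilbert
product norm `‖w‖² + ‖∇w‖²`. (The set of test pairs is a linear subspace already; `span` only
provides the bundling.) -/
def H01sub : Submodule ℝ (WithLp 2 (L2 Ω F × Grad Ω F)) :=
  (Submodule.span ℝ (testPairs Ω F)).topologicalClosure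

/-- `X = H¹₀(Ω; F)` as a type. -/
abbrev H01 : Type _ := H01sub Ω F

end Spaces

section Maps

variable {d : ℕ} {Ω : Set (EuclideanSpace ℝ (Fin d))}
variable {F : Type*} [NormedAddCommGroup F] [InnerProductSpace ℝ F]

/-- The embedding `H¹₀ → L²`. -/
def fn : H01 Ω F →L[ℝ] L2 Ω F :=
  (WithLp.fstL 2 ℝ (L2 Ω F) (Grad Ω F)).comp (H01sub Ω F).subtypeL

/-- The weak gradient `H¹₀ → (L²)ᵈ`. -/
def grad : H01 Ω F →L[ℝ] Grad Ω F :=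
  (WithLp.sndL 2 ℝ (L2 Ω F) (Grad Ω F)).comp (H01sub Ω F).subtypeL

/-- The `L²` inner product `(v, w)_{L²}` on `H¹₀`. -/
def formL2 (v w : H01 Ω F) : ℝ := inner ℝ (fn v) (fn w)

/-- The `H¹₀` inner product `(∇v, ∇w)_{L²}`. -/
def formH1 (v w : H01 Ω F) : ℝ := inner ℝ (grad v) (grad w)

/-- `h = Δw` in the sense of distributions on `Ω`. -/
def IsWeakLaplacian (w h : L2 Ω F) : Prop :=
  ∀ φ : EuclideanSpace ℝ (Fin d) → ℝ, IsTest Ω φ →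
    ∫ x in Ω, (Laplacian.laplacian φ x) • w x = ∫ x in Ω, φ x • h x

end Maps

/-! ## Time-dependent functions on `[0, T]` -/

/-- `w, g ∈ L²(0,T;Z)` and `g = ∂ₜ w` in the sense of vector-valued distributions on `(0,T)`. -/
def HasWeakTimeDeriv {Z : Type*} [NormedAddCommGroup Z] [NormedSpace ℝ Z] (T : ℝ)
    (w g : ℝ → Z) : Prop :=
  MemLp w 2 (volume.restrict (Ioo 0 T)) ∧ MemLp g 2 (volume.restrict (Ioo 0 T)) ∧
    ∀ ψ : ℝ → ℝ, IsTest (Ioo 0 T) ψ →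
      ∫ t in Ioo 0 T, deriv ψ t • w t = - ∫ t in Ioo 0 T, ψ t • g t

section Heat

variable {d : ℕ} {Ω : Set (EuclideanSpace ℝ (Fin d))}
variable {F : Type*} [NormedAddCommGroup F] [InnerProductSpace ℝ F]

/-- `u` is a weak solution on `[0,T]` of `∂ₜu - ν Δu = f` with homogeneous Dirichlet boundary
conditions and time derivative `u₁ = ∂ₜu`: it takes values in `H¹₀`, is continuous into `L²`
(its initial datum is `u 0`), and
`(∂ₜu, v) + ν (∇u, ∇v) = (f, v)` for all `v ∈ H¹₀`, for almost every `t`. -/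
structure IsWeakSolution (ν T : ℝ) (f : ℝ → L2 Ω F) (u : ℝ → H01 Ω F) (u₁ : ℝ → L2 Ω F) :
    Prop where
  continuousOn : ContinuousOn (fun t => fn (u t)) (Icc 0 T)
  timeDeriv : HasWeakTimeDeriv T (fun t => fn (u t)) u₁
  weakForm : ∀ᵐ t ∂(volume.restrict (Ioo 0 T)), ∀ v : H01 Ω F,
    inner ℝ (u₁ t) (fn v) + ν * inner ℝ (grad (u t)) (grad v) = inner ℝ (f t) (fn v)

/-- The regularity condition `u_ttt, Δu_tt, f_tt ∈ L²(0,T;L²(Ω))`, where `u₁ = u_t`, `u₂ = u_tt`,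
`u₃ = u_ttt`, `q = Δu_tt`, `f₁ = f_t`, `f₂ = f_tt`. Since `f ∈ H²(0,T;L²)`, it is identified with
its continuous representative on `[0,T]`, so that the values `f(tₙ)` make sense. -/
structure RegularityCondition (T : ℝ) (u₁ u₂ u₃ q f f₁ f₂ : ℝ → L2 Ω F) : Prop where
  deriv_u₁ : HasWeakTimeDeriv T u₁ u₂
  deriv_u₂ : HasWeakTimeDeriv T u₂ u₃
  memLp_q : MemLp q 2 (volume.restrict (Ioo 0 T))
  laplacian_u₂ : ∀ᵐ t ∂(volume.restrict (Ioo 0 T)), IsWeakLaplacian (u₂ t) (q t)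
  continuousOn_f : ContinuousOn f (Icc 0 T)
  deriv_f : HasWeakTimeDeriv T f f₁
  deriv_f₁ : HasWeakTimeDeriv T f₁ f₂

/-- The regularity constant
`I(u,f) = ‖u_ttt‖² + ‖Δu_tt‖² + ‖f_tt‖²`, squared norms in `L²(0,T;L²(Ω))`. -/
def regConst (T : ℝ) (u₃ q f₂ : ℝ → L2 Ω F) : ℝ :=
  (∫ t in Ioo 0 T, ‖u₃ t‖ ^ 2) + (∫ t in Ioo 0 T, ‖q t‖ ^ 2) + ∫ t in Ioo 0 T, ‖f₂ t‖ ^ 2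

end Heat

/-! ## Proper orthogonal decomposition with difference quotients -/

section POD

variable {V : Type*} [AddCommGroup V] [Module ℝ V]

/-- The data `v⁰, …, v²ᴺ`: the snapshots `u⁰, …, uᴺ` followed by the difference quotients
`∂u¹, …, ∂uᴺ`, where `∂uⁿ = (uⁿ - uⁿ⁻¹) / Δt`. -/
def dqData (N : ℕ) (dt : ℝ) (u : ℕ → V) (m : Fin (2 * N + 1)) : V :=
  if m.val ≤ N then u m.val else dt⁻¹ • (u (m.val - N) - u (m.val - N - 1))

/-- The correlation matrix `K_{mn} = (1/M) (vᵐ, vⁿ)` of `M` data, for the inner product `ip`. -/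
def corrMatrix {M : ℕ} (ip : V → V → ℝ) (v : Fin M → V) : Matrix (Fin M) (Fin M) ℝ :=
  Matrix.of fun m n => (M : ℝ)⁻¹ * ip (v m) (v n)

/-- `lam` are the eigenvalues of the correlation matrix in nonincreasing order, and `z`
corresponding orthonormal eigenvectors. -/
structure IsPOD {M : ℕ} (ip : V → V → ℝ) (v : Fin M → V) (lam : Fin M → ℝ)
    (z : Fin M → EuclideanSpace ℝ (Fin M)) : Prop where
  antitone : Antitone lam
  orthonormal : Orthonormal ℝ z
  eigen : ∀ i, Matrix.mulVec (corrMatrix ip v) (z i) = lam i • (z i : Fin M → ℝ)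

/-- The number `s` of positive POD eigenvalues. -/
def podRank {M : ℕ} (lam : Fin M → ℝ) : ℕ := (Finset.univ.filter fun i => 0 < lam i).card

/-- The POD modes `φᵢ = λᵢ^{-1/2} M^{-1/2} ∑ₘ (zᵢ)ᵐ vᵐ`; they are used for `i < s` only
(indices start at `0`). -/
def podMode {M : ℕ} (v : Fin M → V) (lam : Fin M → ℝ) (z : Fin M → EuclideanSpace ℝ (Fin M))
    (i : Fin M) : V :=
  ((Real.sqrt (lam i))⁻¹ * (Real.sqrt M)⁻¹) • ∑ m, z i m • v m

/-- `X^r`, the span of the first `r` modes. -/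
def podSpace {M : ℕ} (φ : Fin M → V) (r : ℕ) : Submodule ℝ V :=
  Submodule.span ℝ (φ '' {i | i.val < r})

/-- Indices of the truncated modes, `i = r+1, …, s` when counted from `1`. -/
def truncated {M : ℕ} (lam : Fin M → ℝ) (r : ℕ) : Finset (Fin M) :=
  Finset.univ.filter fun i => r ≤ i.val ∧ i.val < podRank lam

end POD

/-! ## Ritz projection and the Crank–Nicolson POD-Galerkin scheme -/

section ROM

variable {d : ℕ} {Ω : Set (EuclideanSpace ℝ (Fin d))}
variable {F : Type*} [NormedAddCommGroup F] [InnerProductSpace ℝ F]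

/-- `p` is a Ritz projection of `w` on `Y`: `p ∈ Y` and `(∇(w - p), ∇v) = 0` for all `v ∈ Y`. -/
def IsRitz (Y : Submodule ℝ (H01 Ω F)) (w p : H01 Ω F) : Prop :=
  p ∈ Y ∧ ∀ v ∈ Y, inner ℝ (grad (w - p)) (grad v) = 0

/-- The Ritz projection `R_r w` on `Y`. -/
def ritz (Y : Submodule ℝ (H01 Ω F)) (w : H01 Ω F) : H01 Ω F :=
  Classical.epsilon (IsRitz Y w)

/-- On a finite-dimensional `Y` the Ritz projection exists. -/
theorem isRitz_ritz (Y : Submodule ℝ (H01 Ω F)) [FiniteDimensional ℝ Y] (w : H01 Ω F) :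
    IsRitz Y w (ritz Y w) := by
  apply Classical.epsilon_spec (p := IsRitz Y w)
  let G : Submodule ℝ (Grad Ω F) := Y.map (grad (Ω := Ω) (F := F)).toLinearMap
  have hfin : FiniteDimensional ℝ G := inferInstance
  have hcomp : CompleteSpace G := FiniteDimensional.complete ℝ G
  have hproj : G.HasOrthogonalProjection :=
    @Submodule.HasOrthogonalProjection.ofCompleteSpace ℝ (Grad Ω F) _ _ _ G hcomp
  obtain ⟨g, hg, hperp⟩ :=
    Submodule.HasOrthogonalProjection.exists_orthogonal (K := G) (grad w)
  obtain ⟨p, hp, rfl⟩ := hg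
  refine ⟨p, hp, fun v hv => ?_⟩
  have h := (Submodule.mem_orthogonal' G _).1 hperp (grad v) ⟨v, hv, rfl⟩
  rw [map_sub]
  exact h

/-- The Crank–Nicolson POD-G-ROM on the space `Y = X^r` with `N` steps of size `dt`:
`ur n ∈ Y` for `n ≤ N`, and for `n < N` and all `v ∈ Y`
`(∂ur^{n+1}, v) + ν (∇ur^{n+1/2}, ∇v) = (f^{n+1/2}, v)`, with
`∂ur^{n+1} = (ur^{n+1} - urⁿ)/dt`, `ur^{n+1/2} = (ur^{n+1} + urⁿ)/2` and
`f^{n+1/2} = (f(t_{n+1}) + f(t_n))/2`. -/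
structure IsCNROM (ν dt : ℝ) (N : ℕ) (f : ℝ → L2 Ω F) (Y : Submodule ℝ (H01 Ω F))
    (ur : ℕ → H01 Ω F) : Prop where
  mem : ∀ n ≤ N, ur n ∈ Y
  scheme : ∀ n < N, ∀ v ∈ Y,
    inner ℝ (fn (dt⁻¹ • (ur (n + 1) - ur n))) (fn v)
      + ν * inner ℝ (grad ((1 / 2 : ℝ) • (ur (n + 1) + ur n))) (grad v)
      = inner ℝ ((1 / 2 : ℝ) • (f (((n + 1 : ℕ) : ℝ) * dt) + f ((n : ℝ) * dt))) (fn v)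

/-- The energy-norm error `‖eᴺ‖²_{L²} + Δt ∑_{n<N} ‖∇e^{n+1/2}‖²_{L²}`. -/
def energyError (dt : ℝ) (N : ℕ) (e : ℕ → H01 Ω F) : ℝ :=
  ‖fn (e N)‖ ^ 2
    + dt * ∑ n ∈ Finset.range N, ‖grad ((1 / 2 : ℝ) • (e (n + 1) + e n))‖ ^ 2

end ROM

end PODHeat

end

open PODHeat

/-! The error splits as `e = η - ψ`, where `η n = u n - R (u n)` is the Ritz projection error and `ψ
n = ur n - R (u n)` lies in the reduced space. The size of `ψ` follows from stability of the scheme,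
that of `η` from an exact POD identity.

Stability: the average of the weak form at two consecutive grid points is compared with the scheme.
The forcing cancels and Ritz orthogonality removes the gradient of `η`, so `ψ` solves the scheme
with residual `∂η` plus the error of the trapezoidal rule for `u_t`. Testing with the average of two
consecutive `ψ` telescopes the L² norm, and Poincaré absorbs the residual into the dissipation
(`discrete_energy_le`). The trapezoidal error, squared and summed over the grid, costs `dt ^ 4`
times the integral of `‖u_ttt‖²`.

POD identity: an orthonormal family of eigenvectors is an orthogonal matrix, so passing from data to
unnormalized modes preserves `∑ ‖L v‖²` for every linear `L`, not only for the map whose inner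
product defines the correlation matrix (`IsPOD.error_identity`). With `L` composed with `1 - R`, the
first `r` modes and those of zero eigenvalue drop out. Since the difference quotients belong to the
data, the sum of `‖∂η‖²` is controlled with no negative power of `dt`; together with the mean of
`‖η‖²` it also bounds the maximum of `η` (`norm_sq_le_average`). For an H¹₀ basis the Ritz
projection is the orthogonal projection on the modes: it annihilates the truncated ones, whose
gradients have norm one.

Pointwise use of the weak form needs representatives. By du Bois-Reymond weak time derivatives come
from primitives, so `u_t` has a continuous version. The identity `u = S (f - u_t)`, with `S` the
Dirichlet solution operator, then extends from almost every time to all times by continuity in L²,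
and injectivity of H¹₀ → L² carries it to the gradients. -/

namespace PODHeat

/-! ### POD identities for arbitrary linear maps -/

section PODIdentities

variable {V H H' : Type*} [AddCommGroup V] [Module ℝ V]
  [NormedAddCommGroup H] [InnerProductSpace ℝ H] [NormedAddCommGroup H'] [InnerProductSpace ℝ H']
  {M : ℕ}

/-- The unnormalized modes `∑ₘ (zᵢ)ᵐ vᵐ`. -/
def rawMode (v : Fin M → V) (z : Fin M → EuclideanSpace ℝ (Fin M)) (i : Fin M) : V :=
  ∑ m, z i m • v m

theorem orthonormal_sum_mul {z : Fin M → EuclideanSpace ℝ (Fin M)} (hz : Orthonormal ℝ z)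
    (i j : Fin M) : ∑ m, z i m * z j m = if i = j then 1 else 0 := by
  rw [← (orthonormal_iff_ite.1 hz) i j, PiLp.inner_apply]
  exact Finset.sum_congr rfl fun m _ => by simp [mul_comm]

/-- As many orthonormal vectors as coordinates form a square matrix, so orthonormal rows force
orthonormal columns. -/
theorem orthonormal_sum_mul' {z : Fin M → EuclideanSpace ℝ (Fin M)} (hz : Orthonormal ℝ z)
    (m n : Fin M) : ∑ i, z i m * z i n = if m = n then 1 else 0 := by
  let Z : Matrix (Fin M) (Fin M) ℝ := Matrix.of fun i m => z i m
  have h1 : Z * Z.transpose = 1 := by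
    ext i j
    rw [Matrix.mul_apply, Matrix.one_apply, ← orthonormal_sum_mul hz i j]
    rfl
  have h2 : Z.transpose * Z = 1 := mul_eq_one_comm.1 h1
  have h3 := congrFun (congrFun h2 m) n
  rw [Matrix.mul_apply, Matrix.one_apply] at h3
  exact h3

/-- An orthogonal change of coordinates preserves the sum of squares. No relation between `L` and
the inner product of the POD is needed, which later allows L² errors of an H¹₀ basis and conversely.
-/
theorem sum_norm_sq_eq_rawMode {z : Fin M → EuclideanSpace ℝ (Fin M)} (hz : Orthonormal ℝ z)
    (v : Fin M → V) (L : V →ₗ[ℝ] H') :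
    ∑ m, ‖L (v m)‖ ^ 2 = ∑ i, ‖L (rawMode v z i)‖ ^ 2 := by
  have h : ∀ i, L (rawMode v z i) = ∑ m, z i m • L (v m) := fun i => by simp [rawMode]
  have h2 : ∀ i, ‖L (rawMode v z i)‖ ^ 2
      = ∑ m, ∑ n, (z i m * z i n) * inner ℝ (L (v m)) (L (v n)) := by
    intro i
    rw [← real_inner_self_eq_norm_sq, h, sum_inner]
    refine Finset.sum_congr rfl fun m _ => ?_
    rw [inner_sum]
    refine Finset.sum_congr rfl fun n _ => ?_
    rw [real_inner_smul_left, real_inner_smul_right]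
    ring
  simp only [h2]
  rw [Finset.sum_comm]
  refine Finset.sum_congr rfl fun m _ => ?_
  rw [Finset.sum_comm]
  simp only [← Finset.sum_mul, orthonormal_sum_mul' hz]
  simp

variable {A : V →ₗ[ℝ] H} {v : Fin M → V} {lam : Fin M → ℝ}
  {z : Fin M → EuclideanSpace ℝ (Fin M)}

/-- The eigenvalue equation for `z i`, paired with `z j`; the factor `M` undoes the normalization of
the correlation matrix. -/
theorem IsPOD.inner_rawMode (h : IsPOD (fun x y => inner ℝ (A x) (A y)) v lam z) (hM : 0 < M)
    (i j : Fin M) :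
    inner ℝ (A (rawMode v z j)) (A (rawMode v z i)) = if j = i then M * lam i else 0 := by
  have hM' : (M : ℝ) ≠ 0 := by positivity
  have key : ∀ m, ∑ n, z i n * inner ℝ (A (v m)) (A (v n)) = M * lam i * z i m := by
    intro m
    have := congrFun (h.eigen i) m
    simp only [Matrix.mulVec, dotProduct, corrMatrix, Matrix.of_apply, Pi.smul_apply,
      smul_eq_mul] at this
    rw [mul_assoc, ← this, Finset.mul_sum]
    refine Finset.sum_congr rfl fun n _ => ?_
    field_simp
  have h1 : ∀ m, inner ℝ (A (v m)) (A (rawMode v z i)) = M * lam i * z i m := by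
    intro m
    simp only [rawMode, map_sum, map_smul, inner_sum, real_inner_smul_right]
    exact key m
  have h2 : A (rawMode v z j) = ∑ m, z j m • A (v m) := by simp [rawMode]
  rw [h2, sum_inner]
  simp only [real_inner_smul_left, h1, mul_left_comm _ (_ * _), ← Finset.mul_sum,
    orthonormal_sum_mul h.orthonormal]
  split_ifs <;> simp

theorem IsPOD.norm_sq_rawMode (h : IsPOD (fun x y => inner ℝ (A x) (A y)) v lam z) (hM : 0 < M)
    (i : Fin M) : ‖A (rawMode v z i)‖ ^ 2 = M * lam i := by
  rw [← real_inner_self_eq_norm_sq, h.inner_rawMode hM, if_pos rfl]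

theorem IsPOD.lam_nonneg (h : IsPOD (fun x y => inner ℝ (A x) (A y)) v lam z) (hM : 0 < M)
    (i : Fin M) : 0 ≤ lam i := by
  have h1 := h.norm_sq_rawMode hM i
  have h2 : 0 ≤ (M : ℝ) * lam i := h1 ▸ sq_nonneg _
  exact nonneg_of_mul_nonneg_right h2 (by positivity)

/-- The rank is defined by counting; monotonicity makes the positive eigenvalues an initial segment,
so the count is also a threshold on indices. -/
theorem lt_podRank_iff (hanti : Antitone lam) (i : Fin M) : i.val < podRank lam ↔ 0 < lam i := by
  classical
  constructor
  · intro hi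
    by_contra hneg
    have hsub : (Finset.univ.filter fun j => 0 < lam j) ⊆ Finset.Iio i := by
      intro j hj
      rw [Finset.mem_filter] at hj
      rw [Finset.mem_Iio]
      by_contra hij
      exact hneg (hj.2.trans_le (hanti (not_lt.1 hij)))
    have := Finset.card_le_card hsub
    rw [Fin.card_Iio] at this
    exact absurd hi (not_lt.2 this)
  · intro hi
    have hsub : Finset.Iic i ⊆ (Finset.univ.filter fun j => 0 < lam j) := by
      intro j hj
      rw [Finset.mem_Iic] at hj
      exact Finset.mem_filter.2 ⟨Finset.mem_univ _, hi.trans_le (hanti hj)⟩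
    have := Finset.card_le_card hsub
    rw [Fin.card_Iic] at this
    exact this

/-- For a positive eigenvalue this is the normalization of the mode. For a zero eigenvalue the raw
mode has zero `A`-norm, hence vanishes by injectivity of `A`, and both sides are zero. -/
theorem IsPOD.norm_sq_map_rawMode (h : IsPOD (fun x y => inner ℝ (A x) (A y)) v lam z)
    (hA : Function.Injective A) (hM : 0 < M) (L : V →ₗ[ℝ] H') (i : Fin M) :
    ‖L (rawMode v z i)‖ ^ 2 = M * (lam i * ‖L (podMode v lam z i)‖ ^ 2) := by
  rcases (h.lam_nonneg hM i).eq_or_lt with h0 | h0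
  · have h1 := h.norm_sq_rawMode hM i
    rw [← h0, mul_zero, sq_eq_zero_iff, norm_eq_zero] at h1
    have h2 : rawMode v z i = 0 := hA (by rw [h1, map_zero])
    rw [h2, ← h0]
    simp
  · have hM' : (0 : ℝ) < M := by positivity
    have h1 : podMode v lam z i = ((Real.sqrt (lam i))⁻¹ * (Real.sqrt M)⁻¹) • rawMode v z i := rfl
    rw [h1, map_smul, norm_smul, mul_pow, Real.norm_eq_abs, sq_abs, mul_pow, inv_pow, inv_pow,
      Real.sq_sqrt h0.le, Real.sq_sqrt hM'.le]
    field_simp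

/-- The POD error identity for a linear map vanishing on the first `r` modes. -/
theorem IsPOD.error_identity (h : IsPOD (fun x y => inner ℝ (A x) (A y)) v lam z)
    (hA : Function.Injective A) (hM : 0 < M) (L : V →ₗ[ℝ] H') {r : ℕ}
    (hL : ∀ i : Fin M, i.val < r → L (podMode v lam z i) = 0) :
    ∑ m, ‖L (v m)‖ ^ 2 = M * ∑ i ∈ truncated lam r, lam i * ‖L (podMode v lam z i)‖ ^ 2 := by
  rw [sum_norm_sq_eq_rawMode h.orthonormal, Finset.mul_sum]
  simp only [h.norm_sq_map_rawMode hA hM L]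
  symm
  -- A term outside `truncated` vanishes: either `L` kills the mode, or the eigenvalue is zero.
  refine Finset.sum_subset (Finset.subset_univ _) fun i _ hi => ?_
  simp only [truncated, Finset.mem_filter, Finset.mem_univ, true_and, not_and_or, not_le,
    not_lt] at hi
  rcases hi with hi | hi
  · rw [hL i hi]
    simp
  · have : lam i = 0 := le_antisymm
      (not_lt.1 fun h0 => absurd ((lt_podRank_iff h.antitone i).2 h0) (not_lt.2 hi))
      (h.lam_nonneg hM i)
    rw [this]
    simp

/-- The POD error identity for a linear map `R` fixing the first `r` modes. -/
theorem IsPOD.projection_error (h : IsPOD (fun x y => inner ℝ (A x) (A y)) v lam z)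
    (hA : Function.Injective A) (hM : 0 < M) (L : V →ₗ[ℝ] H') (R : V →ₗ[ℝ] V) {r : ℕ}
    (hR : ∀ i : Fin M, i.val < r → R (podMode v lam z i) = podMode v lam z i) :
    ∑ m, ‖L (v m - R (v m))‖ ^ 2
      = M * ∑ i ∈ truncated lam r,
          lam i * ‖L (podMode v lam z i - R (podMode v lam z i))‖ ^ 2 := by
  have hL : ∀ w, (L ∘ₗ (LinearMap.id - R)) w = L (w - R w) := fun _ => rfl
  have key := h.error_identity hA hM (L ∘ₗ (LinearMap.id - R)) (r := r) fun i hi => by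
    rw [hL, hR i hi, sub_self, map_zero]
  simpa only [hL] using key

theorem IsPOD.norm_podMode (h : IsPOD (fun x y => inner ℝ (A x) (A y)) v lam z)
    (hM : 0 < M) {i : Fin M} (hi : 0 < lam i) : ‖A (podMode v lam z i)‖ ^ 2 = 1 := by
  have hM' : (0 : ℝ) < M := by positivity
  have h1 : podMode v lam z i = ((Real.sqrt (lam i))⁻¹ * (Real.sqrt M)⁻¹) • rawMode v z i := rfl
  rw [h1, map_smul, norm_smul, mul_pow, Real.norm_eq_abs, sq_abs, mul_pow, inv_pow, inv_pow,
    Real.sq_sqrt hi.le, Real.sq_sqrt hM'.le, h.norm_sq_rawMode hM]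
  field_simp

theorem IsPOD.inner_podMode_eq_zero (h : IsPOD (fun x y => inner ℝ (A x) (A y)) v lam z)
    (hM : 0 < M) {i j : Fin M} (hij : j ≠ i) :
    inner ℝ (A (podMode v lam z j)) (A (podMode v lam z i)) = 0 := by
  have h1 : ∀ i, podMode v lam z i
      = ((Real.sqrt (lam i))⁻¹ * (Real.sqrt M)⁻¹) • rawMode v z i := fun _ => rfl
  rw [h1, h1, map_smul, map_smul, real_inner_smul_left, real_inner_smul_right,
    h.inner_rawMode hM, if_neg hij]
  simp

end PODIdentities

/-! ### Stability properties of test functions -/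

section TestFunctions

variable {E G : Type*} [NormedAddCommGroup E] [NormedSpace ℝ E]
  [NormedAddCommGroup G] [NormedSpace ℝ G] {S : Set E}

theorem IsTest.add {φ ψ : E → G} (hφ : IsTest S φ) (hψ : IsTest S ψ) : IsTest S (φ + ψ) :=
  ⟨hφ.1.add hψ.1, hφ.2.1.add hψ.2.1,
    (tsupport_add φ ψ).trans (union_subset hφ.2.2 hψ.2.2)⟩

theorem IsTest.const_smul {φ : E → G} (hφ : IsTest S φ) (c : ℝ) : IsTest S (c • φ) :=
  ⟨hφ.1.const_smul c, hφ.2.1.smul_left (f := fun _ => c),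
    (tsupport_smul_subset_right (fun _ => c) φ).trans hφ.2.2⟩

theorem IsTest.smul_const {η : E → ℝ} (hη : IsTest S η) (c : G) :
    IsTest S (fun x => η x • c) :=
  ⟨hη.1.smul contDiff_const, hη.2.1.smul_right,
    (tsupport_smul_subset_left η fun _ => c).trans hη.2.2⟩

theorem IsTest.eq_zero_of_notMem {φ : E → G} (hφ : IsTest S φ) {x : E} (hx : x ∉ S) : φ x = 0 :=
  image_eq_zero_of_notMem_tsupport fun h => hx (hφ.2.2 h)

end TestFunctions

/-! ### Lax–Milgram -/

section LaxMilgram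

variable {X H G : Type*} [NormedAddCommGroup X] [InnerProductSpace ℝ X] [CompleteSpace X]
  [NormedAddCommGroup H] [InnerProductSpace ℝ H] [CompleteSpace H]
  [NormedAddCommGroup G] [InnerProductSpace ℝ G]

/-- The form is coercive with constant `ν / c`. Lax–Milgram represents it by an isomorphism `A`, and
`S` is the inverse of `A` after the adjoint of `J`. The equivalence records existence and uniqueness
together. -/
theorem exists_solution_operator_of_coercive (J : X →L[ℝ] H) (D : X →L[ℝ] G) {ν c : ℝ}
    (hν : 0 < ν) (hc : 0 < c) (hD : ∀ w, ‖w‖ ^ 2 ≤ c * ‖D w‖ ^ 2) :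
    ∃ S : H →L[ℝ] X, ∀ (g : H) (w : X),
      (∀ v, ν * inner ℝ (D w) (D v) = (inner ℝ g (J v) : ℝ)) ↔ w = S g := by
  let B : X →L[ℝ] X →L[ℝ] ℝ := ν • (innerSL ℝ (E := G)).bilinearComp D D
  have hB : ∀ w v, B w v = ν * inner ℝ (D w) (D v) := fun w v => rfl
  have hco : IsCoercive B := by
    refine ⟨ν / c, by positivity, fun w => ?_⟩
    rw [hB, real_inner_self_eq_norm_sq, mul_assoc, ← sq, div_mul_eq_mul_div,
      div_le_iff₀ hc, mul_assoc]
    refine mul_le_mul_of_nonneg_left ?_ hν.le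
    linarith [hD w]
  let A := hco.continuousLinearEquivOfBilin
  let J' : H →L[ℝ] X := ContinuousLinearMap.adjoint J
  refine ⟨(A.symm : X →L[ℝ] X).comp J', fun g w => ?_⟩
  have hA : ∀ v, inner ℝ (A w) v = ν * inner ℝ (D w) (D v) := fun v => by
    rw [← hB]
    exact hco.continuousLinearEquivOfBilin_apply w v
  have hJ : ∀ v, inner ℝ (J' g) v = (inner ℝ g (J v) : ℝ) := fun v =>
    ContinuousLinearMap.adjoint_inner_left _ _ _
  have h1 : (w = ((A.symm : X →L[ℝ] X).comp J') g) ↔ A w = J' g :=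
    ContinuousLinearEquiv.eq_symm_apply A
  rw [h1]
  constructor
  · intro h
    refine ext_inner_right ℝ fun v => ?_
    rw [hA, hJ, h]
  · intro h v
    rw [← hA, h, hJ]

end LaxMilgram

/-! ### The space H¹₀: integration by parts, Poincaré, Ritz projection, Dirichlet problem -/

section Euclidean

variable {d : ℕ} {Ω : Set (EuclideanSpace ℝ (Fin d))}
variable {F : Type*} [NormedAddCommGroup F] [InnerProductSpace ℝ F]
variable {φ ψ : EuclideanSpace ℝ (Fin d) → F}

theorem IsTest.differentiable (hφ : IsTest Ω φ) : Differentiable ℝ φ :=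
  hφ.1.differentiable (by simp)

theorem IsTest.continuous_partialDeriv (hφ : IsTest Ω φ) (j : Fin d) :
    Continuous (partialDeriv j φ) :=
  (hφ.1.continuous_fderiv (by simp)).clm_apply continuous_const

theorem IsTest.hasCompactSupport_partialDeriv (hφ : IsTest Ω φ) (j : Fin d) :
    HasCompactSupport (partialDeriv j φ) :=
  (hφ.2.1.fderiv (𝕜 := ℝ)).comp_left
    (g := fun l : EuclideanSpace ℝ (Fin d) →L[ℝ] F => l (EuclideanSpace.single j 1)) (by simp)

theorem IsTest.tsupport_partialDeriv_subset (hφ : IsTest Ω φ) (j : Fin d) :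
    tsupport (partialDeriv j φ) ⊆ Ω := by
  refine Subset.trans ?_ ((tsupport_fderiv_subset ℝ (f := φ)).trans hφ.2.2)
  refine closure_mono fun x hx => ?_
  rw [Function.mem_support] at hx ⊢
  intro h0
  exact hx (by simp [partialDeriv, h0])

theorem IsTest.partialDeriv_eq_zero (hφ : IsTest Ω φ) (j : Fin d) {x} (hx : x ∉ Ω) :
    partialDeriv j φ x = 0 :=
  image_eq_zero_of_notMem_tsupport fun h => hx (hφ.tsupport_partialDeriv_subset j h)

theorem IsTest.memLp (hφ : IsTest Ω φ) : MemLp φ 2 (volume.restrict Ω) :=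
  (hφ.1.continuous.memLp_of_hasCompactSupport hφ.2.1).restrict Ω

theorem IsTest.memLp_partialDeriv (hφ : IsTest Ω φ) (j : Fin d) :
    MemLp (partialDeriv j φ) 2 (volume.restrict Ω) :=
  ((hφ.continuous_partialDeriv j).memLp_of_hasCompactSupport
    (hφ.hasCompactSupport_partialDeriv j)).restrict Ω

theorem integrable_inner_of_hasCompactSupport (hφ : Continuous φ) (hφc : HasCompactSupport φ)
    (hψ : Continuous ψ) : Integrable fun x => (inner ℝ (φ x) (ψ x) : ℝ) :=
  (hφ.inner hψ).integrable_of_hasCompactSupport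
    (hφc.mono fun x hx => by
      rw [Function.mem_support] at hx ⊢
      exact fun h0 => hx (by rw [h0, inner_zero_left]))

theorem IsTest.integral_inner_partialDeriv (hψ : IsTest Ω ψ) (hφ : IsTest Ω φ) (j : Fin d) :
    ∫ x in Ω, (inner ℝ (ψ x) (partialDeriv j φ x) : ℝ)
      = - ∫ x in Ω, inner ℝ (partialDeriv j ψ x) (φ x) := by
  rw [setIntegral_eq_integral_of_forall_compl_eq_zero
      fun x hx => by rw [hψ.eq_zero_of_notMem hx, inner_zero_left],
    setIntegral_eq_integral_of_forall_compl_eq_zero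
      fun x hx => by rw [hφ.eq_zero_of_notMem hx, inner_zero_right]]
  exact integral_bilinear_fderiv_right_eq_neg_left_of_integrable (B := innerSL ℝ)
    (integrable_inner_of_hasCompactSupport (hψ.continuous_partialDeriv j)
      (hψ.hasCompactSupport_partialDeriv j) hφ.1.continuous)
    (integrable_inner_of_hasCompactSupport hψ.1.continuous hψ.2.1 (hφ.continuous_partialDeriv j))
    (integrable_inner_of_hasCompactSupport hψ.1.continuous hψ.2.1 hφ.1.continuous)
    (fun x _ => hψ.differentiable x) (fun x _ => hφ.differentiable x)

/-- Density arguments may then treat a single test function instead of a linear combination, so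
closed nonlinear conditions such as inequalities of norms are covered. -/
theorem mem_testPairs_of_mem_span {p : WithLp 2 (L2 Ω F × Grad Ω F)}
    (hp : p ∈ Submodule.span ℝ (testPairs Ω F)) : p ∈ testPairs Ω F := by
  induction hp using Submodule.span_induction with
  | mem x h => exact h
  | zero =>
    refine ⟨0, ⟨contDiff_const, HasCompactSupport.zero, by simp⟩, ?_, fun j => ?_⟩
    · exact Lp.coeFn_zero _ _ _
    · have h0 : partialDeriv (G := F) j 0 = 0 := by ext x; simp [partialDeriv]
      rw [h0]
      exact Lp.coeFn_zero _ _ _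
  | add x y _ _ hx hy =>
    obtain ⟨φ, hφ, h1, h2⟩ := hx
    obtain ⟨ψ, hψ, h3, h4⟩ := hy
    refine ⟨φ + ψ, hφ.add hψ, ?_, fun j => ?_⟩
    · exact (Lp.coeFn_add x.fst y.fst).trans (h1.add h3)
    · have h0 : partialDeriv j (φ + ψ) = partialDeriv j φ + partialDeriv j ψ := by
        ext x
        simp [partialDeriv, fderiv_add (hφ.differentiable x) (hψ.differentiable x)]
      rw [h0]
      exact (Lp.coeFn_add (x.snd j) (y.snd j)).trans ((h2 j).add (h4 j))
  | smul c x _ hx =>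
    obtain ⟨φ, hφ, h1, h2⟩ := hx
    refine ⟨c • φ, hφ.const_smul c, ?_, fun j => ?_⟩
    · exact (Lp.coeFn_smul c x.fst).trans (h1.const_smul c)
    · have h0 : partialDeriv j (c • φ) = c • partialDeriv j φ := by
        ext x
        simp [partialDeriv, fderiv_const_smul (hφ.differentiable x)]
      rw [h0]
      exact (Lp.coeFn_smul c (x.snd j)).trans ((h2 j).const_smul c)

/-- A closed condition that holds for all test functions holds on `H¹₀`. -/
theorem H01_induction {P : WithLp 2 (L2 Ω F × Grad Ω F) → Prop} (hP : IsClosed {p | P p})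
    (h : ∀ p ∈ testPairs Ω F, P p) (w : H01 Ω F) : P w := by
  have h1 : closure (Submodule.span ℝ (testPairs Ω F) : Set (WithLp 2 (L2 Ω F × Grad Ω F)))
      ⊆ {p | P p} := closure_minimal (fun p hp => h p (mem_testPairs_of_mem_span hp)) hP
  exact h1 w.2

theorem norm_sq_H01 (w : H01 Ω F) : ‖w‖ ^ 2 = ‖fn w‖ ^ 2 + ‖grad w‖ ^ 2 :=
  WithLp.prod_norm_sq_eq_of_L2 (w : WithLp 2 (L2 Ω F × Grad Ω F))

theorem H01_ext_of_fn_grad {w : H01 Ω F} (h1 : fn w = 0) (h2 : grad w = 0) : w = 0 := by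
  have h := norm_sq_H01 w
  rw [h1, h2] at h
  simpa using h

/-- Integration by parts in `H¹₀`. -/
theorem inner_grad_add_inner_fn (w : H01 Ω F) (hψ : IsTest Ω ψ) (j : Fin d) :
    (inner ℝ (hψ.memLp.toLp ψ) (grad w j) : ℝ)
      + inner ℝ ((hψ.memLp_partialDeriv j).toLp _) (fn w) = 0 := by
  refine H01_induction (P := fun p => (inner ℝ (hψ.memLp.toLp ψ) (p.snd j) : ℝ)
      + inner ℝ ((hψ.memLp_partialDeriv j).toLp _) p.fst = 0)
    (isClosed_eq (by fun_prop) continuous_const) ?_ w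
  rintro p ⟨φ, hφ, h1, h2⟩
  rw [L2.inner_def, L2.inner_def]
  have e1 : ∫ x in Ω, (inner ℝ (hψ.memLp.toLp ψ x) (p.snd j x) : ℝ)
      = ∫ x in Ω, inner ℝ (ψ x) (partialDeriv j φ x) := by
    refine integral_congr_ae ?_
    filter_upwards [hψ.memLp.coeFn_toLp, h2 j] with x hx hx'
    rw [hx, hx']
  have e2 : ∫ x in Ω, (inner ℝ ((hψ.memLp_partialDeriv j).toLp _ x) (p.fst x) : ℝ)
      = ∫ x in Ω, inner ℝ (partialDeriv j ψ x) (φ x) := by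
    refine integral_congr_ae ?_
    filter_upwards [(hψ.memLp_partialDeriv j).coeFn_toLp, h1] with x hx hx'
    rw [hx, hx']
  rw [e1, e2, hψ.integral_inner_partialDeriv hφ]
  ring

/-- The weak gradient of an element of `H¹₀` is determined by the function. -/
theorem fn_injective [CompleteSpace F] (hΩ : IsOpen Ω) :
    Function.Injective (fn (Ω := Ω) (F := F)) := by
  refine (injective_iff_map_eq_zero _).2 fun w hw => H01_ext_of_fn_grad hw ?_
  ext1 j
  refine Lp.eq_zero_iff_ae_eq_zero.2 ?_
  have hint : LocallyIntegrableOn (grad w j) Ω volume :=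
    (locallyIntegrableOn_of_locallyIntegrable_restrict
      ((Lp.memLp (grad w j)).locallyIntegrable (by norm_num)))
  refine (ae_restrict_iff' hΩ.measurableSet).2
    (hΩ.ae_eq_zero_of_integral_contDiff_smul_eq_zero hint fun η h1 h2 h3 => ?_)
  have hη : IsTest Ω η := ⟨h1, h2, h3⟩
  rw [← setIntegral_eq_integral_of_forall_compl_eq_zero
    fun x hx => by rw [hη.eq_zero_of_notMem hx, zero_smul]]
  have hi : Integrable (fun x => η x • grad w j x) (volume.restrict Ω) :=
    memLp_one_iff_integrable.1 ((Lp.memLp (grad w j)).smul hη.memLp)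
  -- The integral is `F`-valued; its component along `c` is integration by parts against the vector
  -- test function `η • c`.
  refine ext_inner_left ℝ fun c => ?_
  rw [inner_zero_right, ← integral_inner hi]
  have key := inner_grad_add_inner_fn w (hη.smul_const c) j
  rw [hw, inner_zero_right, add_zero, L2.inner_def] at key
  rw [← key]
  refine integral_congr_ae ?_
  filter_upwards [(hη.smul_const c).memLp.coeFn_toLp] with x hx
  rw [hx, real_inner_smul_left, real_inner_smul_right]

theorem norm_sq_L2 (g : L2 Ω F) : ‖g‖ ^ 2 = ∫ x in Ω, ‖g x‖ ^ 2 := by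
  rw [← real_inner_self_eq_norm_sq, L2.inner_def]
  simp only [real_inner_self_eq_norm_sq]

/-- Since `∂ⱼ xⱼ = 1`, integration by parts gives `∫ ‖φ‖² = -2 ∫ (φ, ∂ⱼφ) xⱼ`. With `|xⱼ| ≤ R`,
Young's inequality bounds the integrand by `‖φ‖² / 2 + 2 R² ‖∂ⱼφ‖²`; absorbing the first term
doubles the constant to `4 R²`. -/
theorem IsTest.poincare (hφ : IsTest Ω φ) {R : ℝ} (hR : ∀ x ∈ Ω, ‖x‖ ≤ R) (j : Fin d) :
    ∫ x in Ω, ‖φ x‖ ^ 2 ≤ 4 * R ^ 2 * ∫ x in Ω, ‖partialDeriv j φ x‖ ^ 2 := by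
  rw [setIntegral_eq_integral_of_forall_compl_eq_zero
      fun x hx => by rw [hφ.eq_zero_of_notMem hx]; simp,
    setIntegral_eq_integral_of_forall_compl_eq_zero
      fun x hx => by rw [hφ.partialDeriv_eq_zero j hx]; simp]
  have hc := hφ.1.continuous
  have hdc := hφ.continuous_partialDeriv j
  have i1 : Integrable fun x => ‖φ x‖ ^ 2 := by
    simpa only [real_inner_self_eq_norm_sq] using
      integrable_inner_of_hasCompactSupport hc hφ.2.1 hc
  have i2 : Integrable fun x => ‖partialDeriv j φ x‖ ^ 2 := by
    simpa only [real_inner_self_eq_norm_sq] using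
      integrable_inner_of_hasCompactSupport hdc (hφ.hasCompactSupport_partialDeriv j) hdc
  let g : EuclideanSpace ℝ (Fin d) →L[ℝ] ℝ := EuclideanSpace.proj j
  have hg : ∀ x, g x = x j := fun _ => rfl
  have i3 : Integrable fun x => 2 * inner ℝ (φ x) (partialDeriv j φ x) * g x := by
    have := integrable_inner_of_hasCompactSupport (φ := φ)
      (ψ := fun x => (2 * g x) • partialDeriv j φ x) hc hφ.2.1 (by fun_prop)
    refine this.congr (Eventually.of_forall fun x => ?_)
    simp only [real_inner_smul_right]
    ring
  have hd : ∀ x, HasFDerivAt (fun x => ‖φ x‖ ^ 2)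
      (2 • (innerSL ℝ (φ x)).comp (fderiv ℝ φ x)) x :=
    fun x => (hφ.differentiable x).hasFDerivAt.norm_sq
  have hd' : ∀ x, fderiv ℝ (fun x => ‖φ x‖ ^ 2) x (EuclideanSpace.single j 1)
      = 2 * inner ℝ (φ x) (partialDeriv j φ x) := by
    intro x
    rw [(hd x).fderiv]
    simp [partialDeriv]
  have hg1 : ∀ x, fderiv ℝ (fun x => g x) x (EuclideanSpace.single j 1) = 1 := by
    intro x
    rw [g.hasFDerivAt.fderiv, hg]
    simp
  have key := integral_mul_fderiv_eq_neg_fderiv_mul_of_integrable (μ := volume)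
    (f := fun x => ‖φ x‖ ^ 2) (g := fun x => g x) (v := EuclideanSpace.single j (1 : ℝ))
    (by simpa only [hd'] using i3) (by simpa only [hg1, mul_one] using i1)
    ((by
      have := integrable_inner_of_hasCompactSupport (φ := φ) (ψ := fun x => g x • φ x)
        hc hφ.2.1 (by fun_prop)
      refine this.congr (Eventually.of_forall fun x => ?_)
      simp only [real_inner_smul_right, real_inner_self_eq_norm_sq]
      ring))
    (fun x _ => (hd x).differentiableAt) (fun x _ => g.differentiableAt)
  simp only [hd', hg1, mul_one] at key
  rw [← integral_neg] at key
  have hle : ∫ x, ‖φ x‖ ^ 2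
      ≤ ∫ x, (1 / 2 * ‖φ x‖ ^ 2 + 2 * R ^ 2 * ‖partialDeriv j φ x‖ ^ 2) := by
    rw [key]
    refine integral_mono i3.neg ((i1.const_mul _).add (i2.const_mul _)) fun x => ?_
    by_cases hx : x ∈ Ω
    · have h1 : |g x| ≤ R := (PiLp.norm_apply_le x j).trans (hR x hx)
      have h2 := abs_real_inner_le_norm (φ x) (partialDeriv j φ x)
      have h3 : |inner ℝ (φ x) (partialDeriv j φ x) * g x|
          ≤ ‖φ x‖ * ‖partialDeriv j φ x‖ * R := by
        rw [abs_mul]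
        exact mul_le_mul h2 h1 (abs_nonneg _) (by positivity)
      have h4 := neg_le_of_abs_le h3
      simp only
      nlinarith [sq_nonneg (‖φ x‖ - 2 * R * ‖partialDeriv j φ x‖)]
    · simp [hφ.eq_zero_of_notMem hx, hφ.partialDeriv_eq_zero j hx]
  rw [integral_add (i1.const_mul _) (i2.const_mul _), integral_const_mul,
    integral_const_mul] at hle
  linarith

/-- The Poincaré inequality on a bounded set. -/
theorem exists_poincare (hd : 0 < d) (hΩb : Bornology.IsBounded Ω) :
    ∃ C : ℝ, 0 < C ∧ ∀ w : H01 Ω F, ‖fn w‖ ^ 2 ≤ C * ‖grad w‖ ^ 2 := by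
  obtain ⟨R, hR0, hR⟩ := hΩb.exists_pos_norm_le
  refine ⟨4 * R ^ 2, by positivity, fun w => ?_⟩
  refine H01_induction (P := fun p => ‖p.fst‖ ^ 2 ≤ 4 * R ^ 2 * ‖p.snd‖ ^ 2)
    (isClosed_le (by fun_prop) (by fun_prop)) ?_ w
  rintro p ⟨φ, hφ, h1, h2⟩
  -- One direction suffices; positive dimension provides coordinate `0`.
  have h3 : ‖p.snd ⟨0, hd⟩‖ ^ 2 ≤ ‖p.snd‖ ^ 2 :=
    pow_le_pow_left₀ (norm_nonneg _) (PiLp.norm_apply_le p.snd _) 2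
  refine le_trans ?_ (mul_le_mul_of_nonneg_left h3 (by positivity))
  rw [norm_sq_L2, norm_sq_L2]
  have e1 : ∫ x in Ω, ‖p.fst x‖ ^ 2 = ∫ x in Ω, ‖φ x‖ ^ 2 :=
    integral_congr_ae (h1.mono fun x hx => by simp only [hx])
  have e2 : ∫ x in Ω, ‖p.snd ⟨0, hd⟩ x‖ ^ 2 = ∫ x in Ω, ‖partialDeriv ⟨0, hd⟩ φ x‖ ^ 2 :=
    integral_congr_ae ((h2 ⟨0, hd⟩).mono fun x hx => by simp only [hx])
  rw [e1, e2]
  exact hφ.poincare hR _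

theorem grad_injective (hd : 0 < d) (hΩb : Bornology.IsBounded Ω) :
    Function.Injective (grad (Ω := Ω) (F := F)) := by
  obtain ⟨C, -, hC⟩ := exists_poincare (Ω := Ω) (F := F) hd hΩb
  refine (injective_iff_map_eq_zero _).2 fun w hw => H01_ext_of_fn_grad ?_ hw
  have h := hC w
  rw [hw] at h
  have h0 : ‖fn w‖ ^ 2 ≤ 0 := by simpa using h
  simpa using le_antisymm h0 (sq_nonneg _)

/-- The difference of two candidates lies in `Y` and its gradient is orthogonal to itself. As `ritz`
is an arbitrary choice, uniqueness is what makes it linear and computable on particular vectors. -/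
theorem IsRitz.unique (hinj : Function.Injective (grad (Ω := Ω) (F := F)))
    {Y : Submodule ℝ (H01 Ω F)} {w p p' : H01 Ω F} (h : IsRitz Y w p) (h' : IsRitz Y w p') :
    p = p' := by
  have h1 := h.2 (p - p') (Y.sub_mem h.1 h'.1)
  have h2 := h'.2 (p - p') (Y.sub_mem h.1 h'.1)
  have h3 : grad (p - p') = grad (w - p') - grad (w - p) := by
    rw [← map_sub]
    congr 1
    abel
  have h4 : inner ℝ (grad (p - p')) (grad (p - p')) = (0 : ℝ) := by
    nth_rewrite 1 [h3]
    rw [inner_sub_left, h1, h2, sub_zero]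
  rw [inner_self_eq_zero] at h4
  exact sub_eq_zero.1 (hinj (h4.trans (map_zero _).symm))

/-- The Ritz projection as a linear map. -/
noncomputable def ritzLM (hinj : Function.Injective (grad (Ω := Ω) (F := F)))
    (Y : Submodule ℝ (H01 Ω F)) [FiniteDimensional ℝ Y] : H01 Ω F →ₗ[ℝ] H01 Ω F where
  toFun := ritz Y
  map_add' w w' := by
    refine (isRitz_ritz Y (w + w')).unique hinj ?_
    obtain ⟨h1, h2⟩ := isRitz_ritz Y w
    obtain ⟨h3, h4⟩ := isRitz_ritz Y w'
    refine ⟨Y.add_mem h1 h3, fun v hv => ?_⟩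
    rw [add_sub_add_comm, map_add, inner_add_left, h2 v hv, h4 v hv, add_zero]
  map_smul' c w := by
    refine (isRitz_ritz Y (c • w)).unique hinj ?_
    obtain ⟨h1, h2⟩ := isRitz_ritz Y w
    refine ⟨Y.smul_mem c h1, fun v hv => ?_⟩
    rw [RingHom.id_apply, ← smul_sub, map_smul, real_inner_smul_left, h2 v hv, mul_zero]

/-- The solution operator of the Dirichlet problem for `-ν Δ`. -/
theorem exists_solution_operator [CompleteSpace F] (hd : 0 < d) (hΩb : Bornology.IsBounded Ω)
    {ν : ℝ} (hν : 0 < ν) :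
    ∃ S : L2 Ω F →L[ℝ] H01 Ω F, ∀ (g : L2 Ω F) (w : H01 Ω F),
      (∀ v : H01 Ω F, ν * inner ℝ (grad w) (grad v) = (inner ℝ g (fn v) : ℝ)) ↔ w = S g := by
  have : CompleteSpace (H01 Ω F) :=
    (Submodule.isClosed_topologicalClosure _).completeSpace_coe
  obtain ⟨C, hC0, hC⟩ := exists_poincare (Ω := Ω) (F := F) hd hΩb
  have hco : ∀ w : H01 Ω F, ‖w‖ ^ 2 ≤ (C + 1) * ‖grad w‖ ^ 2 := fun w => by
    rw [norm_sq_H01]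
    linarith [hC w]
  have hpos : 0 < C + 1 := by positivity
  have key := exists_solution_operator_of_coercive (X := H01 Ω F) (H := L2 Ω F)
    (G := Grad Ω F) fn grad hν hpos
  obtain ⟨S, hS⟩ := key hco
  exact ⟨S, fun g w => hS g w⟩

end Euclidean

/-! ### Weak time derivatives and the trapezoidal rule -/

section WeakTimeDeriv

variable {Z : Type*} [NormedAddCommGroup Z] {T : ℝ}

theorem integrable_of_memLp_two {w : ℝ → Z} (hw : MemLp w 2 (volume.restrict (Ioo 0 T))) :
    Integrable w (volume.restrict (Ioo 0 T)) :=
  hw.integrable (by norm_num)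

/-- Cauchy–Schwarz, from the nonnegative integral of the squared deviation of `‖g‖` from its mean.
-/
theorem sq_integral_norm_le {a b : ℝ} (hab : a ≤ b) {g : ℝ → Z}
    (h1 : IntervalIntegrable (fun t => ‖g t‖) volume a b)
    (h2 : IntervalIntegrable (fun t => ‖g t‖ ^ 2) volume a b) :
    (∫ t in a..b, ‖g t‖) ^ 2 ≤ (b - a) * ∫ t in a..b, ‖g t‖ ^ 2 := by
  rcases hab.eq_or_lt with rfl | hlt
  · simp
  set I := ∫ t in a..b, ‖g t‖
  have hpos : 0 < b - a := sub_pos.2 hlt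
  have h3 : 0 ≤ ∫ t in a..b, (‖g t‖ - I / (b - a)) ^ 2 :=
    intervalIntegral.integral_nonneg hab fun _ _ => sq_nonneg _
  have h4 : ∀ t, (‖g t‖ - I / (b - a)) ^ 2
      = ‖g t‖ ^ 2 - 2 * (I / (b - a)) * ‖g t‖ + (I / (b - a)) ^ 2 := fun t => by ring
  simp only [h4] at h3
  rw [intervalIntegral.integral_add (h2.sub (h1.const_mul _)) intervalIntegrable_const,
    intervalIntegral.integral_sub h2 (h1.const_mul _), intervalIntegral.integral_const_mul,
    intervalIntegral.integral_const, smul_eq_mul] at h3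
  have h5 : (∫ t in a..b, ‖g t‖ ^ 2) - 2 * (I / (b - a)) * I + (b - a) * (I / (b - a)) ^ 2
      = (∫ t in a..b, ‖g t‖ ^ 2) - I ^ 2 / (b - a) := by
    field_simp
    ring
  have h6 : I ^ 2 / (b - a) ≤ ∫ t in a..b, ‖g t‖ ^ 2 := by
    change 0 ≤ (∫ t in a..b, ‖g t‖ ^ 2) - 2 * (I / (b - a)) * I + _ at h3
    linarith
  rw [div_le_iff₀ hpos] at h6
  linarith

variable [NormedSpace ℝ Z]

/-- Fubini on the triangle `s ≤ t`: the integral of `ψ'` over `[s, T)` is `-ψ s`, because `ψ`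
vanishes at `T`. -/
theorem integral_deriv_smul_primitive [CompleteSpace Z] {g : ℝ → Z}
    (hg : Integrable g (volume.restrict (Ioo 0 T)))
    {ψ : ℝ → ℝ} (hψ : IsTest (Ioo 0 T) ψ) :
    ∫ t in Ioo 0 T, deriv ψ t • (∫ s in (0 : ℝ)..t, g s) = - ∫ t in Ioo 0 T, ψ t • g t := by
  set μ := volume.restrict (Ioo (0 : ℝ) T)
  have hdc : Continuous (deriv ψ) := hψ.1.continuous_deriv (by simp)
  have hdi : Integrable (deriv ψ) μ :=
    (hdc.integrable_of_hasCompactSupport hψ.2.1.deriv).restrict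
  have hL : ∀ t ∈ Ioo (0 : ℝ) T, deriv ψ t • (∫ s in (0 : ℝ)..t, g s)
      = ∫ s, {p : ℝ × ℝ | p.2 ≤ p.1}.indicator (fun p => deriv ψ p.1 • g p.2) (t, s) ∂μ := by
    intro t ht
    have h1 : ∀ s, {p : ℝ × ℝ | p.2 ≤ p.1}.indicator (fun p => deriv ψ p.1 • g p.2) (t, s)
        = (Iic t).indicator (fun s => deriv ψ t • g s) s := fun s => by
      simp [indicator_apply]
    simp only [h1]
    rw [setIntegral_indicator measurableSet_Iic, integral_smul,
      intervalIntegral.integral_of_le ht.1.le]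
    congr 2
    have : Ioo 0 T ∩ Iic t = Ioc 0 t := by
      ext s
      simp only [mem_inter_iff, mem_Ioo, mem_Iic, mem_Ioc]
      exact ⟨fun h => ⟨h.1.1, h.2⟩, fun h => ⟨⟨h.1, h.2.trans_lt ht.2⟩, h.2⟩⟩
    rw [this]
  have hR : ∀ s ∈ Ioo (0 : ℝ) T,
      ∫ t, {p : ℝ × ℝ | p.2 ≤ p.1}.indicator (fun p => deriv ψ p.1 • g p.2) (t, s) ∂μ
        = - (ψ s • g s) := by
    intro s hs
    have h1 : ∀ t, {p : ℝ × ℝ | p.2 ≤ p.1}.indicator (fun p => deriv ψ p.1 • g p.2) (t, s)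
        = (Ici s).indicator (fun t => deriv ψ t) t • g s := fun t => by
      by_cases h : s ≤ t <;> simp [h]
    simp only [h1]
    rw [integral_smul_const, setIntegral_indicator measurableSet_Ici]
    have h2 : Ioo 0 T ∩ Ici s = Ico s T := by
      ext t
      simp only [mem_inter_iff, mem_Ioo, mem_Ici, mem_Ico]
      exact ⟨fun h => ⟨h.2, h.1.2⟩, fun h => ⟨⟨hs.1.trans_le h.1, h.2⟩, h.1⟩⟩
    rw [h2, integral_Ico_eq_integral_Ioc, ← intervalIntegral.integral_of_le hs.2.le,
      intervalIntegral.integral_deriv_eq_sub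
        (fun t _ => hψ.1.differentiable (by simp) t) (hdc.intervalIntegrable _ _),
      hψ.eq_zero_of_notMem (x := T) (by simp), zero_sub, neg_smul]
  have hint : Integrable (Function.uncurry fun t s =>
      {p : ℝ × ℝ | p.2 ≤ p.1}.indicator (fun p => deriv ψ p.1 • g p.2) (t, s)) (μ.prod μ) :=
    (hdi.smul_prod hg).indicator (measurableSet_le measurable_snd measurable_fst)
  rw [setIntegral_congr_fun measurableSet_Ioo hL, integral_integral_swap hint,
    setIntegral_congr_fun measurableSet_Ioo hR, integral_neg]

theorem exists_isTest_integral_eq_one (hT : 0 < T) :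
    ∃ ρ : ℝ → ℝ, IsTest (Ioo 0 T) ρ ∧ ∫ t, ρ t = 1 := by
  let b : ContDiffBump (T / 2) := ⟨T / 8, T / 4, by positivity, by linarith⟩
  refine ⟨b.normed volume, ⟨b.contDiff_normed, b.hasCompactSupport_normed, ?_⟩, b.integral_normed⟩
  rw [b.tsupport_normed_eq, Real.closedBall_eq_Icc]
  intro t ht
  have h1 : T / 2 - T / 4 ≤ t := ht.1
  have h2 : t ≤ T / 2 + T / 4 := ht.2
  exact ⟨by linarith, by linarith⟩

/-- To the left of the support the primitive has not started; to the right it equals the total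
integral, which is zero. -/
theorem isTest_primitive (hT : 0 < T) {k : ℝ → ℝ} (hk : IsTest (Ioo 0 T) k)
    (h0 : ∫ t, k t = 0) :
    IsTest (Ioo 0 T) (fun t => ∫ s in (0 : ℝ)..t, k s)
      ∧ ∀ t, deriv (fun t => ∫ s in (0 : ℝ)..t, k s) t = k t := by
  have hkc := hk.1.continuous
  have hder : ∀ t, HasDerivAt (fun t => ∫ s in (0 : ℝ)..t, k s) (k t) t := fun t =>
    hkc.integral_hasStrictDerivAt 0 t |>.hasDerivAt
  have hd : ∀ t, deriv (fun t => ∫ s in (0 : ℝ)..t, k s) t = k t := fun t => (hder t).deriv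
  refine ⟨?_, hd⟩
  have hsm : ContDiff ℝ ∞ fun t => ∫ s in (0 : ℝ)..t, k s := by
    refine contDiff_infty_iff_deriv.2 ⟨fun t => (hder t).differentiableAt, ?_⟩
    rw [funext hd]
    exact hk.1
  -- The point `T / 2` keeps `K` nonempty when `k = 0`, so that its infimum and supremum lie in the
  -- interval.
  let K : Set ℝ := tsupport k ∪ {T / 2}
  have hKc : IsCompact K := hk.2.1.isCompact.union isCompact_singleton
  have hKn : K.Nonempty := ⟨T / 2, Or.inr rfl⟩
  have hKs : K ⊆ Ioo 0 T :=
    union_subset hk.2.2 (singleton_subset_iff.2 ⟨by linarith, by linarith⟩)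
  have hk0 : ∀ s, s ∉ Icc (sInf K) (sSup K) → k s = 0 := fun s hs =>
    image_eq_zero_of_notMem_tsupport fun h =>
      hs ⟨csInf_le hKc.bddBelow (Or.inl h), le_csSup hKc.bddAbove (Or.inl h)⟩
  have ha := hKs (hKc.sInf_mem hKn)
  have hb := hKs (hKc.sSup_mem hKn)
  have hz : ∀ t, t ∉ Icc (sInf K) (sSup K) → ∫ s in (0 : ℝ)..t, k s = 0 := by
    intro t ht
    by_cases h : t < sInf K
    · have : ∀ s ∈ uIcc 0 t, k s = 0 := fun s hs => hk0 s fun h' => by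
        rcases le_max_iff.1 (show s ≤ max 0 t from hs.2) with h1 | h1
        · linarith [ha.1, h'.1]
        · linarith [h'.1]
      rw [intervalIntegral.integral_congr (g := fun _ => 0) this]
      simp
    · have h' : sSup K < t := by
        by_contra h''
        exact ht ⟨not_lt.1 h, not_lt.1 h''⟩
      have h0t : 0 ≤ t := (hb.1.trans h').le
      rw [intervalIntegral.integral_of_le h0t, setIntegral_eq_integral_of_forall_compl_eq_zero, h0]
      intro s hs
      refine hk0 s fun hs' => hs ⟨ha.1.trans_le hs'.1, (hs'.2.trans_lt h').le⟩
  have hsub : tsupport (fun t => ∫ s in (0 : ℝ)..t, k s) ⊆ Icc (sInf K) (sSup K) := by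
    refine closure_minimal (fun t ht => ?_) isClosed_Icc
    by_contra h
    exact ht (hz t h)
  exact ⟨hsm, isCompact_Icc.of_isClosed_subset (isClosed_tsupport _) hsub,
    hsub.trans fun t ht => ⟨ha.1.trans_le ht.1, ht.2.trans_lt hb.2⟩⟩

/-- The lemma of du Bois-Reymond. -/
theorem exists_ae_eq_const [CompleteSpace Z] (hT : 0 < T) {h : ℝ → Z}
    (hi : Integrable h (volume.restrict (Ioo 0 T)))
    (h0 : ∀ ψ : ℝ → ℝ, IsTest (Ioo 0 T) ψ → ∫ t in Ioo 0 T, deriv ψ t • h t = 0) :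
    ∃ c, ∀ᵐ t ∂(volume.restrict (Ioo 0 T)), h t = c := by
  obtain ⟨ρ, hρ, hρ1⟩ := exists_isTest_integral_eq_one hT
  have hsm : ∀ {θ : ℝ → ℝ}, IsTest (Ioo 0 T) θ →
      Integrable (fun t => θ t • h t) (volume.restrict (Ioo 0 T)) := by
    intro θ hθ
    obtain ⟨C, hC⟩ := hθ.1.continuous.bounded_above_of_compact_support hθ.2.1
    exact hi.bdd_smul C hθ.1.continuous.aestronglyMeasurable (Eventually.of_forall hC)
  have hint : ∀ {θ : ℝ → ℝ}, IsTest (Ioo 0 T) θ → Integrable θ := fun hθ =>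
    hθ.1.continuous.integrable_of_hasCompactSupport hθ.2.1
  set c := ∫ t in Ioo 0 T, ρ t • h t
  refine ⟨c, ?_⟩
  have hloc : LocallyIntegrableOn (fun t => h t - c) (Ioo 0 T) volume :=
    IntegrableOn.locallyIntegrableOn
      (Integrable.sub hi (integrable_const (μ := volume.restrict (Ioo 0 T)) c))
  have key := isOpen_Ioo.ae_eq_zero_of_integral_contDiff_smul_eq_zero hloc fun θ h1 h2 h3 => by
    have hθ : IsTest (Ioo 0 T) θ := ⟨h1, h2, h3⟩
    -- Subtracting a multiple of `ρ` gives mean zero, so the result is the derivative of a test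
    -- function; the subtracted multiple produces the constant `c`.
    have hk : IsTest (Ioo 0 T) (θ + (-∫ t, θ t) • ρ) := hθ.add (hρ.const_smul _)
    obtain ⟨ht1, ht2⟩ := isTest_primitive hT hk (by
      simp only [Pi.add_apply, Pi.smul_apply, smul_eq_mul]
      rw [integral_add (hint hθ) ((hint hρ).const_mul _), integral_const_mul, hρ1]
      ring)
    have h4 := h0 _ ht1
    simp only [ht2] at h4
    simp only [Pi.add_apply, Pi.smul_apply, smul_eq_mul, add_smul, mul_smul] at h4
    have h5 : Integrable (fun t => (-∫ t, θ t) • (ρ t • h t)) (volume.restrict (Ioo 0 T)) :=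
      (hsm hρ).smul _
    rw [integral_add (hsm hθ) h5, integral_smul] at h4
    rw [← setIntegral_eq_integral_of_forall_compl_eq_zero (s := Ioo 0 T)
      fun x hx => by rw [hθ.eq_zero_of_notMem hx, zero_smul]]
    simp only [smul_sub]
    rw [integral_sub (hsm hθ) ((hint hθ).restrict.smul_const c), integral_smul_const,
      setIntegral_eq_integral_of_forall_compl_eq_zero (f := θ)
        fun x hx => hθ.eq_zero_of_notMem hx, sub_eq_add_neg, ← neg_smul]
    exact h4
  rw [ae_restrict_iff' measurableSet_Ioo]
  exact key.mono fun t ht hm => sub_eq_zero.1 (ht hm)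

/-- A function with a weak time derivative is a.e. equal to a primitive of it. -/
theorem HasWeakTimeDeriv.exists_ae_eq_primitive [CompleteSpace Z] (hT : 0 < T) {w g : ℝ → Z}
    (h : HasWeakTimeDeriv T w g) :
    ∃ c, ∀ᵐ t ∂(volume.restrict (Ioo 0 T)), w t = c + ∫ s in (0 : ℝ)..t, g s := by
  have hw := integrable_of_memLp_two h.1
  have hg := integrable_of_memLp_two h.2.1
  have hg' : IntegrableOn g (uIcc 0 T) := by
    rw [uIcc_of_le hT.le, integrableOn_Icc_iff_integrableOn_Ioo]
    exact hg
  have hGc : ContinuousOn (fun t => ∫ s in (0 : ℝ)..t, g s) (Icc 0 T) := by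
    have := intervalIntegral.continuousOn_primitive_interval hg'
    rwa [uIcc_of_le hT.le] at this
  have hG : Integrable (fun t => ∫ s in (0 : ℝ)..t, g s) (volume.restrict (Ioo 0 T)) :=
    (hGc.integrableOn_Icc).mono_set Ioo_subset_Icc_self
  obtain ⟨c, hc⟩ := exists_ae_eq_const hT (hw.sub hG) fun ψ hψ => by
    have hdc : Continuous (deriv ψ) := hψ.1.continuous_deriv (by simp)
    obtain ⟨C, hC⟩ := hdc.bounded_above_of_compact_support hψ.2.1.deriv
    have hsm : ∀ {k : ℝ → Z}, Integrable k (volume.restrict (Ioo 0 T)) →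
        Integrable (fun t => deriv ψ t • k t) (volume.restrict (Ioo 0 T)) := fun hk =>
      hk.bdd_smul C hdc.aestronglyMeasurable (Eventually.of_forall hC)
    simp only [Pi.sub_apply, smul_sub]
    rw [integral_sub (hsm hw) (hsm hG), h.2.2 ψ hψ, integral_deriv_smul_primitive hg hψ, sub_self]
  exact ⟨c, hc.mono fun t ht => sub_eq_iff_eq_add.1 ht⟩

/-- The error of the trapezoidal rule. -/
theorem norm_trapezoid_le [CompleteSpace Z] {W W' : ℝ → Z} (hW : ∀ t, HasDerivAt W (W' t) t)
    (hW' : Continuous W') {a b K : ℝ} (hab : a ≤ b) (hK : ∀ t ∈ Icc a b, ‖W' t - W' a‖ ≤ K) :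
    ‖((b - a) / 2) • (W b + W a) - ∫ t in a..b, W t‖ ≤ (b - a) ^ 2 / 2 * K := by
  set m := (a + b) / 2
  -- Integration by parts with the weight `t - m`, which has zero integral about the midpoint; the
  -- constant `W' a` can therefore be subtracted from `W'` for free.
  have hder : ∀ t, HasDerivAt (fun t => (t - m) • W t - ((t - m) ^ 2 / 2) • W' a)
      (W t + (t - m) • (W' t - W' a)) t := by
    intro t
    have h1 : HasDerivAt (fun t : ℝ => t - m) 1 t := (hasDerivAt_id t).sub_const m
    have h2 : HasDerivAt (fun t : ℝ => (t - m) ^ 2 / 2) (t - m) t := by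
      simpa using (h1.fun_pow 2).div_const 2
    refine ((h1.fun_smul (hW t)).fun_sub (h2.smul_const (W' a))).congr_deriv ?_
    module
  have hWc : Continuous W := continuous_iff_continuousAt.2 fun t => (hW t).continuousAt
  have hc2 : Continuous fun t => (t - m) • (W' t - W' a) := by fun_prop
  have hftc := intervalIntegral.integral_eq_sub_of_hasDerivAt (a := a) (b := b)
    (fun t _ => hder t) ((hWc.add hc2).intervalIntegrable _ _)
  rw [intervalIntegral.integral_add (hWc.intervalIntegrable _ _)
    (hc2.intervalIntegrable _ _)] at hftc
  have hval : ((b - m) • W b - ((b - m) ^ 2 / 2) • W' a)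
      - ((a - m) • W a - ((a - m) ^ 2 / 2) • W' a) = ((b - a) / 2) • (W b + W a) := by
    have e1 : b - m = (b - a) / 2 := by simp only [m]; ring
    have e2 : a - m = -((b - a) / 2) := by simp only [m]; ring
    rw [e1, e2]
    module
  rw [hval] at hftc
  rw [← hftc, add_sub_cancel_left]
  have hb := intervalIntegral.norm_integral_le_of_norm_le_const (a := a) (b := b)
    (f := fun t => (t - m) • (W' t - W' a)) (C := (b - a) / 2 * K) fun t ht => by
      rw [uIoc_of_le hab] at ht
      have ht' : t ∈ Icc a b := ⟨ht.1.le, ht.2⟩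
      rw [norm_smul]
      refine mul_le_mul ?_ (hK t ht') (norm_nonneg _) (by linarith)
      rw [Real.norm_eq_abs, abs_le]
      simp only [m]
      constructor <;> linarith [ht'.1, ht'.2]
  rw [abs_of_nonneg (by linarith)] at hb
  linarith

/-- A function with three weak time derivatives: its first derivative has a continuous
representative, which satisfies the trapezoidal rule of second order. -/
theorem exists_continuous_deriv_trapezoid [CompleteSpace Z] (hT : 0 < T) {w w₁ w₂ w₃ : ℝ → Z}
    (hw : ContinuousOn w (Icc 0 T)) (h1 : HasWeakTimeDeriv T w w₁)
    (h2 : HasWeakTimeDeriv T w₁ w₂) (h3 : HasWeakTimeDeriv T w₂ w₃) :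
    ∃ W : ℝ → Z, Continuous W ∧ (∀ᵐ t ∂(volume.restrict (Ioo 0 T)), w₁ t = W t) ∧
      ∀ a b : ℝ, 0 ≤ a → a ≤ b → b ≤ T →
        ‖((b - a) / 2) • (W b + W a) - (w b - w a)‖ ^ 2
          ≤ (b - a) ^ 5 / 4 * ∫ t in a..b, ‖w₃ t‖ ^ 2 := by
  obtain ⟨c₀, hc₀⟩ := h1.exists_ae_eq_primitive hT
  obtain ⟨c₁, hc₁⟩ := h2.exists_ae_eq_primitive hT
  obtain ⟨c₂, hc₂⟩ := h3.exists_ae_eq_primitive hT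
  have hcongr : ∀ {k k' : ℝ → Z}, (∀ᵐ t ∂(volume.restrict (Ioo 0 T)), k t = k' t) →
      ∀ t ∈ Icc 0 T, ∫ s in (0 : ℝ)..t, k s = ∫ s in (0 : ℝ)..t, k' s := by
    intro k k' hk t ht
    rw [intervalIntegral.integral_of_le ht.1, intervalIntegral.integral_of_le ht.1,
      integral_Ioc_eq_integral_Ioo, integral_Ioc_eq_integral_Ioo]
    exact integral_congr_ae (ae_restrict_of_ae_restrict_of_subset (Ioo_subset_Ioo_right ht.2) hk)
  -- Extension by zero makes all the primitives below continuous on the whole line.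
  let g : ℝ → Z := (Ioo 0 T).indicator w₃
  have hg : Integrable g :=
    (integrable_indicator_iff measurableSet_Ioo).2 (integrable_of_memLp_two h3.2.1)
  have hgw : ∀ᵐ t ∂(volume.restrict (Ioo 0 T)), w₃ t = g t :=
    (ae_restrict_mem measurableSet_Ioo).mono fun t ht => (indicator_of_mem ht _).symm
  let W₂ : ℝ → Z := fun t => c₂ + ∫ s in (0 : ℝ)..t, g s
  have hW₂c : Continuous W₂ :=
    continuous_const.add (intervalIntegral.continuous_primitive
      (fun a b => hg.intervalIntegrable) 0)
  have hW₂ : ∀ᵐ t ∂(volume.restrict (Ioo 0 T)), w₂ t = W₂ t := by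
    filter_upwards [hc₂, ae_restrict_mem measurableSet_Ioo] with t ht htm
    rw [ht, hcongr hgw t (Ioo_subset_Icc_self htm)]
  let W : ℝ → Z := fun t => c₁ + ∫ s in (0 : ℝ)..t, W₂ s
  have hWd : ∀ t, HasDerivAt W (W₂ t) t := fun t =>
    ((hW₂c.integral_hasStrictDerivAt 0 t).hasDerivAt).const_add c₁
  have hWc : Continuous W := continuous_iff_continuousAt.2 fun t => (hWd t).continuousAt
  have hW : ∀ᵐ t ∂(volume.restrict (Ioo 0 T)), w₁ t = W t := by
    filter_upwards [hc₁, ae_restrict_mem measurableSet_Ioo] with t ht htm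
    rw [ht, hcongr hW₂ t (Ioo_subset_Icc_self htm)]
  -- Both sides are continuous on `[0, T]`, so almost everywhere equality becomes equality at every
  -- point, endpoints included.
  have hwW : EqOn w (fun t => c₀ + ∫ s in (0 : ℝ)..t, W s) (Icc 0 T) := by
    have hc : Continuous fun t => c₀ + ∫ s in (0 : ℝ)..t, W s :=
      continuous_const.add (intervalIntegral.continuous_primitive
        (fun a b => hWc.intervalIntegrable a b) 0)
    refine Measure.eqOn_Icc_of_ae_eq volume hT.ne ?_ hw hc.continuousOn
    rw [restrict_Ioo_eq_restrict_Icc.symm]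
    filter_upwards [hc₀, ae_restrict_mem measurableSet_Ioo] with t ht htm
    rw [ht, hcongr hW t (Ioo_subset_Icc_self htm)]
  refine ⟨W, hWc, hW, fun a b ha hab hb => ?_⟩
  have hwab : w b - w a = ∫ t in a..b, W t := by
    rw [hwW ⟨ha.trans hab, hb⟩, hwW ⟨ha, hab.trans hb⟩, add_sub_add_left_eq_sub,
      intervalIntegral.integral_interval_sub_left (hWc.intervalIntegrable _ _)
        (hWc.intervalIntegrable _ _)]
  have hIoo : Ioo a b ⊆ Ioo 0 T := Ioo_subset_Ioo ha hb
  have hn1 : IntervalIntegrable (fun t => ‖g t‖) volume a b := hg.norm.intervalIntegrable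
  have hn2 : IntervalIntegrable (fun t => ‖w₃ t‖ ^ 2) volume a b := by
    rw [intervalIntegrable_iff_integrableOn_Ioo_of_le hab]
    exact (h3.2.1.integrable_norm_pow (by norm_num)).mono_measure (Measure.restrict_mono hIoo le_rfl)
  have hgI : ∀ t ∈ Ioo a b, g t = w₃ t := fun t ht => indicator_of_mem (hIoo ht) _
  have hn2' : IntervalIntegrable (fun t => ‖g t‖ ^ 2) volume a b := by
    rw [intervalIntegrable_iff_integrableOn_Ioo_of_le hab] at hn2 ⊢
    exact hn2.congr_fun (fun t ht => by simp only [hgI t ht]) measurableSet_Ioo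
  have heq : ∫ t in a..b, ‖g t‖ ^ 2 = ∫ t in a..b, ‖w₃ t‖ ^ 2 := by
    rw [intervalIntegral.integral_of_le hab, intervalIntegral.integral_of_le hab,
      integral_Ioc_eq_integral_Ioo, integral_Ioc_eq_integral_Ioo]
    exact setIntegral_congr_fun measurableSet_Ioo fun t ht => by simp only [hgI t ht]
  set K := ∫ t in a..b, ‖g t‖
  -- The oscillation of the second derivative is at most the L¹ norm of the third; Cauchy–Schwarz
  -- turns its square into one more factor `b - a`, whence the fifth power.
  have hK : ∀ t ∈ Icc a b, ‖W₂ t - W₂ a‖ ≤ K := by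
    intro t ht
    have e : W₂ t - W₂ a = ∫ s in a..t, g s := by
      simp only [W₂]
      rw [add_sub_add_left_eq_sub, intervalIntegral.integral_interval_sub_left
        hg.intervalIntegrable hg.intervalIntegrable]
    rw [e]
    refine (intervalIntegral.norm_integral_le_integral_norm ht.1).trans ?_
    exact intervalIntegral.integral_mono_interval le_rfl ht.1 ht.2
      (Eventually.of_forall fun _ => norm_nonneg _) hn1
  have htr := norm_trapezoid_le hWd hW₂c hab hK
  rw [hwab, ← heq]
  have hcs := sq_integral_norm_le hab hn1 hn2'
  calc _ ≤ ((b - a) ^ 2 / 2 * K) ^ 2 := pow_le_pow_left₀ (norm_nonneg _) htr 2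
    _ = (b - a) ^ 4 / 4 * K ^ 2 := by ring
    _ ≤ (b - a) ^ 4 / 4 * ((b - a) * ∫ t in a..b, ‖g t‖ ^ 2) :=
        mul_le_mul_of_nonneg_left hcs (by positivity)
    _ = _ := by ring

end WeakTimeDeriv

/-! ### The weak form at every time -/

section WeakForm

variable {d : ℕ} {Ω : Set (EuclideanSpace ℝ (Fin d))}
variable {F : Type*} [NormedAddCommGroup F] [InnerProductSpace ℝ F]

/-- The weak form holds at every time, for continuous representatives. -/
theorem IsWeakSolution.weakForm_everywhere [CompleteSpace F] (hd : 0 < d) (hΩ : IsOpen Ω)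
    (hΩb : Bornology.IsBounded Ω) {ν T : ℝ} (hν : 0 < ν) (hT : 0 < T) {f : ℝ → L2 Ω F}
    {u : ℝ → H01 Ω F} {u₁ U : ℝ → L2 Ω F} (h : IsWeakSolution ν T f u u₁)
    (hf : ContinuousOn f (Icc 0 T)) (hU : Continuous U)
    (hu : ∀ᵐ t ∂(volume.restrict (Ioo 0 T)), u₁ t = U t) :
    ∀ t ∈ Icc 0 T, ∀ v : H01 Ω F,
      inner ℝ (U t) (fn v) + ν * inner ℝ (grad (u t)) (grad v) = inner ℝ (f t) (fn v) := by
  obtain ⟨S, hS⟩ := exists_solution_operator (Ω := Ω) (F := F) hd hΩb hν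
  have hae : ∀ᵐ t ∂(volume.restrict (Icc 0 T)), fn (u t) = fn (S (f t - U t)) := by
    rw [← restrict_Ioo_eq_restrict_Icc]
    filter_upwards [h.weakForm, hu] with t ht htu
    rw [(hS (f t - U t) (u t)).1 fun v => ?_]
    rw [inner_sub_left, ← ht v, htu]
    ring
  have hcont : ContinuousOn (fun t => fn (S (f t - U t))) (Icc 0 T) :=
    fn.continuous.comp_continuousOn (S.continuous.comp_continuousOn (hf.sub hU.continuousOn))
  have heq := Measure.eqOn_Icc_of_ae_eq volume hT.ne hae h.continuousOn hcont
  intro t ht v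
  -- Continuity gave equality only in L²; injectivity of `fn` lifts it to H¹₀, hence to the
  -- gradients.
  have h1 := (hS (f t - U t) (u t)).2 (fn_injective hΩ (heq ht)) v
  rw [h1, inner_sub_left]
  ring

end WeakForm

/-! ### Discrete energy and error estimates -/

section DiscreteEstimates

theorem norm_add_sq_le_two {E : Type*} [SeminormedAddCommGroup E] (a b : E) :
    ‖a + b‖ ^ 2 ≤ 2 * ‖a‖ ^ 2 + 2 * ‖b‖ ^ 2 := by
  have h := pow_le_pow_left₀ (norm_nonneg _) (norm_add_le a b) 2
  nlinarith [sq_nonneg (‖a‖ - ‖b‖)]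

theorem norm_sub_sq_le_two {E : Type*} [SeminormedAddCommGroup E] (a b : E) :
    ‖a - b‖ ^ 2 ≤ 2 * ‖a‖ ^ 2 + 2 * ‖b‖ ^ 2 := by
  have h := norm_add_sq_le_two a (-b)
  rwa [norm_neg, ← sub_eq_add_neg] at h

variable {V L G : Type*} [AddCommGroup V] [Module ℝ V] [NormedAddCommGroup L]
  [InnerProductSpace ℝ L] [NormedAddCommGroup G] [InnerProductSpace ℝ G]
  {J : V →ₗ[ℝ] L} {D : V →ₗ[ℝ] G} {ν T dt P : ℝ} {N : ℕ}

/-- Discrete energy estimate for the Crank–Nicolson scheme. -/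
theorem discrete_energy_le (hν : 0 < ν) (hdt : 0 < dt) (hP : 0 < P)
    (hJD : ∀ w, ‖J w‖ ^ 2 ≤ P * ‖D w‖ ^ 2) {ψ : ℕ → V} {ρ : ℕ → L}
    (h : ∀ n < N, inner ℝ (J (dt⁻¹ • (ψ (n + 1) - ψ n))) (J ((1 / 2 : ℝ) • (ψ (n + 1) + ψ n)))
      + ν * ‖D ((1 / 2 : ℝ) • (ψ (n + 1) + ψ n))‖ ^ 2
      = inner ℝ (ρ n) (J ((1 / 2 : ℝ) • (ψ (n + 1) + ψ n)))) :
    ∀ k ≤ N, ‖J (ψ k)‖ ^ 2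
      + ν * (dt * ∑ n ∈ Finset.range k, ‖D ((1 / 2 : ℝ) • (ψ (n + 1) + ψ n))‖ ^ 2)
      ≤ ‖J (ψ 0)‖ ^ 2 + P / ν * (dt * ∑ n ∈ Finset.range k, ‖ρ n‖ ^ 2) := by
  intro k
  induction k with
  | zero => simp
  | succ k ih =>
    intro hk
    have h1 := ih (by omega)
    have h2 := h k (by omega)
    set m := (1 / 2 : ℝ) • (ψ (k + 1) + ψ k) with hm
    have h3 : inner ℝ (J (dt⁻¹ • (ψ (k + 1) - ψ k))) (J m)
        = (‖J (ψ (k + 1))‖ ^ 2 - ‖J (ψ k)‖ ^ 2) / (2 * dt) := by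
      rw [hm, map_smul, map_smul, map_sub, map_add, real_inner_smul_left, real_inner_smul_right,
        inner_sub_left, inner_add_right, inner_add_right, real_inner_self_eq_norm_sq,
        real_inner_self_eq_norm_sq, real_inner_comm (J (ψ k)) (J (ψ (k + 1)))]
      field_simp
      ring
    -- The Young weights are chosen so that, after Poincaré, exactly half of the dissipation `ν ‖D
    -- m‖²` is used up.
    have h4 : inner ℝ (ρ k) (J m) ≤ P / (2 * ν) * ‖ρ k‖ ^ 2 + ν / 2 * ‖D m‖ ^ 2 := by
      have h5 := real_inner_le_norm (ρ k) (J m)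
      have h6 : ‖ρ k‖ * ‖J m‖ ≤ P / (2 * ν) * ‖ρ k‖ ^ 2 + ν / (2 * P) * ‖J m‖ ^ 2 := by
        have h8 : P / (2 * ν) * ‖ρ k‖ ^ 2 + ν / (2 * P) * ‖J m‖ ^ 2 - ‖ρ k‖ * ‖J m‖
            = (P * ‖ρ k‖ - ν * ‖J m‖) ^ 2 / (2 * ν * P) := by
          field_simp
          ring
        have h9 : 0 ≤ (P * ‖ρ k‖ - ν * ‖J m‖) ^ 2 / (2 * ν * P) := by positivity
        linarith
      have h10 : ν / (2 * P) * ‖J m‖ ^ 2 ≤ ν / (2 * P) * (P * ‖D m‖ ^ 2) :=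
        mul_le_mul_of_nonneg_left (hJD m) (by positivity)
      have h11 : ν / (2 * P) * (P * ‖D m‖ ^ 2) = ν / 2 * ‖D m‖ ^ 2 := by
        field_simp
      linarith
    rw [h3] at h2
    have h12 : (‖J (ψ (k + 1))‖ ^ 2 - ‖J (ψ k)‖ ^ 2) / (2 * dt)
        ≤ P / (2 * ν) * ‖ρ k‖ ^ 2 - ν / 2 * ‖D m‖ ^ 2 := by linarith
    rw [div_le_iff₀ (by positivity)] at h12
    have h13 : (P / (2 * ν) * ‖ρ k‖ ^ 2 - ν / 2 * ‖D m‖ ^ 2) * (2 * dt)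
        = P / ν * (dt * ‖ρ k‖ ^ 2) - ν * (dt * ‖D m‖ ^ 2) := by
      field_simp
    rw [Finset.sum_range_succ, Finset.sum_range_succ, ← hm]
    simp only [mul_add]
    linarith

theorem norm_sub_le_sum_range {E : Type*} [SeminormedAddCommGroup E] (η : ℕ → E) {k m : ℕ}
    (hk : k ≤ N) (hm : m ≤ N) :
    ‖η k - η m‖ ≤ ∑ n ∈ Finset.range N, ‖η (n + 1) - η n‖ := by
  wlog hkm : k ≤ m generalizing k m
  · rw [norm_sub_rev]
    exact this hm hk (not_le.1 hkm).le
  rw [← dist_eq_norm]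
  refine (dist_le_Ico_sum_dist η hkm).trans ?_
  have h1 : ∀ n, dist (η n) (η (n + 1)) = ‖η (n + 1) - η n‖ := fun n => by
    rw [dist_comm, dist_eq_norm]
  simp only [h1]
  refine Finset.sum_le_sum_of_subset_of_nonneg (fun n hn => ?_) fun _ _ _ => norm_nonneg _
  rw [Finset.mem_Ico] at hn
  exact Finset.mem_range.2 (by omega)

/-- The maximum of a grid function is controlled by averages of its values and difference
quotients. -/
theorem norm_sq_le_average {E : Type*} [NormedAddCommGroup E] [NormedSpace ℝ E] (hN : 0 < N)
    (hT : 0 < T) (hdt : dt = T / N) (η : ℕ → E) {k : ℕ} (hk : k ≤ N) :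
    ‖η k‖ ^ 2 ≤ 2 / (N + 1) * ∑ n ∈ Finset.range (N + 1), ‖η n‖ ^ 2
      + 2 * T * (dt * ∑ n ∈ Finset.range N, ‖dt⁻¹ • (η (n + 1) - η n)‖ ^ 2) := by
  have hN' : (0 : ℝ) < N := by positivity
  have hdt0 : 0 < dt := by rw [hdt]; positivity
  set Q := ∑ n ∈ Finset.range N, ‖η (n + 1) - η n‖
  -- Cauchy–Schwarz over `N` steps, with `N * dt = T`.
  have hQ : Q ^ 2 ≤ T * (dt * ∑ n ∈ Finset.range N, ‖dt⁻¹ • (η (n + 1) - η n)‖ ^ 2) := by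
    have h1 : Q ^ 2 ≤ N * ∑ n ∈ Finset.range N, ‖η (n + 1) - η n‖ ^ 2 := by
      simpa using sq_sum_le_card_mul_sum_sq (s := Finset.range N)
        (f := fun n => ‖η (n + 1) - η n‖)
    refine h1.trans (le_of_eq ?_)
    have h2 : ∀ n, ‖dt⁻¹ • (η (n + 1) - η n)‖ ^ 2 = (dt ^ 2)⁻¹ * ‖η (n + 1) - η n‖ ^ 2 :=
      fun n => by rw [norm_smul, mul_pow, Real.norm_eq_abs, sq_abs, inv_pow]
    simp only [h2]
    rw [← Finset.mul_sum]
    have h3 : T = N * dt := by rw [hdt]; field_simp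
    rw [h3]
    field_simp
  -- The value at `k` differs from that at any `m` by at most the total variation `Q`; averaging
  -- over the `N + 1` choices of `m` follows.
  have h1 : ∀ m ∈ Finset.range (N + 1), ‖η k‖ ^ 2 ≤ 2 * ‖η m‖ ^ 2 + 2 * Q ^ 2 := by
    intro m hm
    have h2 := norm_sub_le_sum_range η hk (Finset.mem_range_succ_iff.1 hm)
    have h3 := norm_add_sq_le_two (η m) (η k - η m)
    rw [add_sub_cancel] at h3
    have h4 := pow_le_pow_left₀ (norm_nonneg _) h2 2
    linarith
  have h2 := Finset.sum_le_sum h1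
  rw [Finset.sum_const, Finset.card_range, Finset.sum_add_distrib, Finset.sum_const,
    Finset.card_range, ← Finset.mul_sum, nsmul_eq_mul, nsmul_eq_mul] at h2
  push_cast at h2
  have h3 : ‖η k‖ ^ 2 ≤ 2 / (N + 1) * ∑ n ∈ Finset.range (N + 1), ‖η n‖ ^ 2 + 2 * Q ^ 2 := by
    have h4 : 2 / ((N : ℝ) + 1) * ∑ n ∈ Finset.range (N + 1), ‖η n‖ ^ 2
        = (2 * ∑ n ∈ Finset.range (N + 1), ‖η n‖ ^ 2) / (N + 1) := by ring
    rw [h4, ← sub_le_iff_le_add, le_div_iff₀ (by positivity)]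
    linarith
  linarith

theorem sum_dqData {E : Type*} [AddCommMonoid E] (w : ℕ → V) (Φ : V → E) :
    ∑ m, Φ (dqData N dt w m) = ∑ n ∈ Finset.range (N + 1), Φ (w n)
      + ∑ n ∈ Finset.range N, Φ (dt⁻¹ • (w (n + 1) - w n)) := by
  let g : ℕ → V := fun m => if m ≤ N then w m else dt⁻¹ • (w (m - N) - w (m - N - 1))
  have h1 : ∑ m, Φ (dqData N dt w m) = ∑ m ∈ Finset.range (2 * N + 1), Φ (g m) :=
    Fin.sum_univ_eq_sum_range (fun m => Φ (g m)) _
  rw [h1, show 2 * N + 1 = N + 1 + N by ring, Finset.sum_range_add]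
  congr 1
  · refine Finset.sum_congr rfl fun n hn => ?_
    simp only [g]
    rw [if_pos (Finset.mem_range_succ_iff.1 hn)]
  · refine Finset.sum_congr rfl fun n _ => ?_
    simp only [g]
    rw [if_neg (by omega), show N + 1 + n - N = n + 1 by omega, Nat.add_sub_cancel]

/-- The constant in the error estimates; `P` is the Poincaré constant. -/
noncomputable def romConst (ν T P : ℝ) : ℝ :=
  8 + 12 * T ^ 2 + 6 * T + (2 + 2 / ν) * (1 + P / ν * (6 * T + 1))

theorem romConst_pos (hν : 0 < ν) (hT : 0 < T) (hP : 0 < P) : 0 < romConst ν T P := by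
  unfold romConst
  positivity

/-- Error estimate for the Crank–Nicolson scheme on a subspace `Y` with Ritz projection `R`, in
terms of the projection errors of the snapshots and difference quotients and of the consistency
error of the trapezoidal rule. -/
theorem crankNicolson_error_le (hν : 0 < ν) (hT : 0 < T) (hP : 0 < P) (hN : 0 < N)
    (hdt : dt = T / N) (hJD : ∀ w, ‖J w‖ ^ 2 ≤ P * ‖D w‖ ^ 2) {Y : Submodule ℝ V}
    {R : V →ₗ[ℝ] V} (hR : ∀ w, R w ∈ Y)
    (hRorth : ∀ w, ∀ v ∈ Y, inner ℝ (D (w - R w)) (D v) = (0 : ℝ))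
    {u ur : ℕ → V} {U f : ℕ → L}
    (hweak : ∀ n ≤ N, ∀ v, inner ℝ (U n) (J v) + ν * inner ℝ (D (u n)) (D v) = inner ℝ (f n) (J v))
    (hmem : ∀ n ≤ N, ur n ∈ Y)
    (hscheme : ∀ n < N, ∀ v ∈ Y, inner ℝ (J (dt⁻¹ • (ur (n + 1) - ur n))) (J v)
      + ν * inner ℝ (D ((1 / 2 : ℝ) • (ur (n + 1) + ur n))) (D v)
      = inner ℝ ((1 / 2 : ℝ) • (f (n + 1) + f n)) (J v))
    {I₀ : ℕ → ℝ} {I A B : ℝ} (hI : ∑ n ∈ Finset.range N, I₀ n ≤ I)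
    (htrap : ∀ n < N, ‖(dt / 2) • (U (n + 1) + U n) - (J (u (n + 1)) - J (u n))‖ ^ 2
      ≤ dt ^ 5 / 4 * I₀ n)
    (hA : ∑ m, ‖J (dqData N dt u m - R (dqData N dt u m))‖ ^ 2 = ((2 * N + 1 : ℕ) : ℝ) * A)
    (hB : ∑ m, ‖D (dqData N dt u m - R (dqData N dt u m))‖ ^ 2 = ((2 * N + 1 : ℕ) : ℝ) * B)
    (hI0 : 0 ≤ I) :
    (∀ k ≤ N, ‖J (u k - ur k)‖ ^ 2
      ≤ romConst ν T P * (A + ‖J (ur 0 - R (u 0))‖ ^ 2 + dt ^ 4 * I)) ∧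
    ‖J (u N - ur N)‖ ^ 2 + dt * ∑ n ∈ Finset.range N,
        ‖D ((1 / 2 : ℝ) • ((u (n + 1) - ur (n + 1)) + (u n - ur n)))‖ ^ 2
      ≤ romConst ν T P * (A + B + ‖J (ur 0 - R (u 0))‖ ^ 2 + dt ^ 4 * I) := by
  have hN' : (1 : ℝ) ≤ N := by exact_mod_cast hN
  have hdt0 : 0 < dt := by rw [hdt]; positivity
  have hNdt : (N : ℝ) * dt = T := by rw [hdt]; field_simp
  set ψ : ℕ → V := fun n => ur n - R (u n) with hψ
  set η : ℕ → V := fun n => u n - R (u n) with hη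
  -- The residual of `ψ` in the scheme: the difference quotient of the projection error plus the
  -- consistency error of the trapezoidal rule.
  set ρ : ℕ → L := fun n => J (dt⁻¹ • (η (n + 1) - η n))
    + dt⁻¹ • ((dt / 2) • (U (n + 1) + U n) - (J (u (n + 1)) - J (u n))) with hρ
  have hLdq : ∀ n, dt⁻¹ • (u (n + 1) - u n) - R (dt⁻¹ • (u (n + 1) - u n))
      = dt⁻¹ • (η (n + 1) - η n) := fun n => by
    simp only [hη, map_smul, map_sub]
    module
  rw [sum_dqData u fun w => ‖J (w - R w)‖ ^ 2] at hA
  rw [sum_dqData u fun w => ‖D (w - R w)‖ ^ 2] at hB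
  simp only [hLdq] at hA hB
  push_cast at hA hB
  change ∑ n ∈ Finset.range (N + 1), ‖J (η n)‖ ^ 2 + _ = _ at hA
  change ∑ n ∈ Finset.range (N + 1), ‖D (η n)‖ ^ 2 + _ = _ at hB
  set A₁ := ∑ n ∈ Finset.range (N + 1), ‖J (η n)‖ ^ 2
  set A₂ := ∑ n ∈ Finset.range N, ‖J (dt⁻¹ • (η (n + 1) - η n))‖ ^ 2
  set B₁ := ∑ n ∈ Finset.range (N + 1), ‖D (η n)‖ ^ 2
  set B₂ := ∑ n ∈ Finset.range N, ‖D (dt⁻¹ • (η (n + 1) - η n))‖ ^ 2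
  have hA1 : 0 ≤ A₁ := Finset.sum_nonneg fun _ _ => sq_nonneg _
  have hA2 : 0 ≤ A₂ := Finset.sum_nonneg fun _ _ => sq_nonneg _
  have hB1 : 0 ≤ B₁ := Finset.sum_nonneg fun _ _ => sq_nonneg _
  have hB2 : 0 ≤ B₂ := Finset.sum_nonneg fun _ _ => sq_nonneg _
  have hA0 : 0 ≤ A := nonneg_of_mul_nonneg_right (a := 2 * (N : ℝ) + 1) (by linarith) (by linarith)
  have hB0 : 0 ≤ B := nonneg_of_mul_nonneg_right (a := 2 * (N : ℝ) + 1) (by linarith) (by linarith)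
  -- A sum over the data becomes a time integral: `2 N + 1 ≤ 3 N` because `N ≥ 1`, and `N * dt = T`.
  have hscale : ∀ {X Y : ℝ}, 0 ≤ Y → X ≤ (2 * N + 1) * Y → dt * X ≤ 3 * T * Y := by
    intro X Y hY hX
    have h1 : dt * X ≤ dt * ((2 * N + 1) * Y) := mul_le_mul_of_nonneg_left hX hdt0.le
    have h2 : dt * ((2 * N + 1) * Y) ≤ dt * ((3 * N) * Y) := by gcongr; linarith
    have h3 : dt * ((3 * N) * Y) = 3 * T * Y := by rw [← hNdt]; ring
    linarith
  have hηk : ∀ k ≤ N, ‖J (η k)‖ ^ 2 ≤ (4 + 6 * T ^ 2) * A := by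
    intro k hk
    have h1 := norm_sq_le_average hN hT hdt (fun n => J (η n)) hk
    have h2 : ∑ n ∈ Finset.range N, ‖dt⁻¹ • (J (η (n + 1)) - J (η n))‖ ^ 2 = A₂ := by
      simp only [A₂, map_smul, map_sub]
    simp only [h2] at h1
    -- Here `2 (2 N + 1) / (N + 1) ≤ 4`.
    have h3 : 2 / ((N : ℝ) + 1) * A₁ ≤ 4 * A := by
      rw [div_mul_eq_mul_div, div_le_iff₀ (by positivity)]
      nlinarith
    have h4 := hscale hA0 (X := A₂) (by linarith)
    have h5 : 2 * T * (dt * A₂) ≤ 2 * T * (3 * T * A) :=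
      mul_le_mul_of_nonneg_left h4 (by positivity)
    change ‖J (η k)‖ ^ 2 ≤ 2 / ((N : ℝ) + 1) * A₁ + 2 * T * (dt * A₂) at h1
    linarith
  have hρsum : dt * ∑ n ∈ Finset.range N, ‖ρ n‖ ^ 2 ≤ 6 * T * A + dt ^ 4 * I := by
    have h1 : ∀ n ∈ Finset.range N, ‖ρ n‖ ^ 2
        ≤ 2 * ‖J (dt⁻¹ • (η (n + 1) - η n))‖ ^ 2 + dt ^ 3 / 2 * I₀ n := by
      intro n hn
      have h2 := htrap n (Finset.mem_range.1 hn)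
      refine (norm_add_sq_le_two _ _).trans ?_
      rw [norm_smul, mul_pow, Real.norm_eq_abs, sq_abs]
      have h3 : (dt⁻¹) ^ 2 * ‖(dt / 2) • (U (n + 1) + U n) - (J (u (n + 1)) - J (u n))‖ ^ 2
          ≤ (dt⁻¹) ^ 2 * (dt ^ 5 / 4 * I₀ n) := mul_le_mul_of_nonneg_left h2 (by positivity)
      have h4 : (dt⁻¹) ^ 2 * (dt ^ 5 / 4 * I₀ n) = dt ^ 3 / 4 * I₀ n := by field_simp
      linarith
    have h2 := Finset.sum_le_sum h1
    rw [Finset.sum_add_distrib, ← Finset.mul_sum, ← Finset.mul_sum] at h2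
    have h3 := mul_le_mul_of_nonneg_left h2 hdt0.le
    have h4 := hscale hA0 (X := A₂) (by linarith)
    have h5 : dt ^ 4 / 2 * ∑ n ∈ Finset.range N, I₀ n ≤ dt ^ 4 / 2 * I :=
      mul_le_mul_of_nonneg_left hI (by positivity)
    have h6 : 0 ≤ dt ^ 4 * I := by positivity
    have h7 : dt * (2 * A₂ + dt ^ 3 / 2 * ∑ n ∈ Finset.range N, I₀ n)
        = 2 * (dt * A₂) + dt ^ 4 / 2 * ∑ n ∈ Finset.range N, I₀ n := by ring
    change _ ≤ dt * (2 * A₂ + dt ^ 3 / 2 * ∑ n ∈ Finset.range N, I₀ n) at h3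
    linarith
  have hψmem : ∀ n ≤ N, ψ n ∈ Y := fun n hn => Y.sub_mem (hmem n hn) (hR _)
  have hstep : ∀ n < N,
      inner ℝ (J (dt⁻¹ • (ψ (n + 1) - ψ n))) (J ((1 / 2 : ℝ) • (ψ (n + 1) + ψ n)))
      + ν * ‖D ((1 / 2 : ℝ) • (ψ (n + 1) + ψ n))‖ ^ 2
      = inner ℝ (ρ n) (J ((1 / 2 : ℝ) • (ψ (n + 1) + ψ n))) := by
    intro n hn
    have hv : (1 / 2 : ℝ) • (ψ (n + 1) + ψ n) ∈ Y :=
      Y.smul_mem _ (Y.add_mem (hψmem _ (by omega)) (hψmem _ (by omega)))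
    set v := (1 / 2 : ℝ) • (ψ (n + 1) + ψ n) with hvdef
    have e1 := hscheme n hn v hv
    have e2 := hweak n (by omega) v
    have e3 := hweak (n + 1) (by omega) v
    have e4 := hRorth (u n) v hv
    have e5 := hRorth (u (n + 1)) v hv
    have e6 : J (dt⁻¹ • (ψ (n + 1) - ψ n)) = J (dt⁻¹ • (ur (n + 1) - ur n))
        - dt⁻¹ • (J (u (n + 1)) - J (u n)) + J (dt⁻¹ • (η (n + 1) - η n)) := by
      simp only [hψ, hη, map_smul, map_sub]
      module
    -- The last summand is the gradient of the averaged projection error, orthogonal to `D v` by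
    -- `e4` and `e5`.
    have e7 : D v = D ((1 / 2 : ℝ) • (ur (n + 1) + ur n)) - (1 / 2 : ℝ) • (D (u (n + 1)) + D (u n))
        + (1 / 2 : ℝ) • (D (u (n + 1) - R (u (n + 1))) + D (u n - R (u n))) := by
      simp only [hvdef, hψ, map_smul, map_sub, map_add]
      module
    have e8 : ρ n = J (dt⁻¹ • (η (n + 1) - η n)) + (1 / 2 : ℝ) • (U (n + 1) + U n)
        - dt⁻¹ • (J (u (n + 1)) - J (u n)) := by
      simp only [hρ, smul_sub, smul_smul]
      rw [show dt⁻¹ * (dt / 2) = 1 / 2 by field_simp]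
      module
    have e9 : ‖D v‖ ^ 2 = inner ℝ (D ((1 / 2 : ℝ) • (ur (n + 1) + ur n))) (D v)
        - 1 / 2 * (inner ℝ (D (u (n + 1))) (D v) + inner ℝ (D (u n)) (D v)) := by
      rw [← real_inner_self_eq_norm_sq]
      nth_rewrite 1 [e7]
      rw [inner_add_left, inner_sub_left, real_inner_smul_left, real_inner_smul_left,
        inner_add_left, inner_add_left, e4, e5]
      ring
    rw [e9, e6, e8]
    simp only [inner_add_left, inner_sub_left, real_inner_smul_left] at e1 ⊢
    linarith
  have henergy := discrete_energy_le hν hdt0 hP hJD hstep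
  set p := ‖J (ur 0 - R (u 0))‖ ^ 2
  have hp : 0 ≤ p := sq_nonneg _
  have hPν : 0 < P / ν := by positivity
  have hI4 : 0 ≤ dt ^ 4 * I := by positivity
  have hbound : ∀ k ≤ N, ‖J (ψ k)‖ ^ 2
      + ν * (dt * ∑ n ∈ Finset.range k, ‖D ((1 / 2 : ℝ) • (ψ (n + 1) + ψ n))‖ ^ 2)
      ≤ (1 + P / ν * (6 * T + 1)) * (A + p + dt ^ 4 * I) := by
    intro k hk
    have h1 : dt * ∑ n ∈ Finset.range k, ‖ρ n‖ ^ 2 ≤ 6 * T * A + dt ^ 4 * I :=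
      (mul_le_mul_of_nonneg_left (Finset.sum_le_sum_of_subset_of_nonneg
        (Finset.range_mono hk) fun _ _ _ => sq_nonneg _) hdt0.le).trans hρsum
    have h2 : 6 * T * A + dt ^ 4 * I ≤ (6 * T + 1) * (A + p + dt ^ 4 * I) := by
      have : 0 ≤ 6 * T * p + 6 * T * (dt ^ 4 * I) := by positivity
      linarith
    have h3 := mul_le_mul_of_nonneg_left (h1.trans h2) hPν.le
    have h4 := henergy k hk
    change _ ≤ p + _ at h4
    linarith
  have hek : ∀ n, u n - ur n = η n - ψ n := fun n => by
    simp only [hη, hψ]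
    abel
  set Z := (1 + P / ν * (6 * T + 1)) * (A + p + dt ^ 4 * I) with hZ
  have hZ0 : 0 ≤ Z := by positivity
  have hmax : ∀ k ≤ N, ‖J (u k - ur k)‖ ^ 2 ≤ (8 + 12 * T ^ 2) * A + 2 * Z := by
    intro k hk
    rw [hek, map_sub]
    have h1 := norm_sub_sq_le_two (J (η k)) (J (ψ k))
    have h2 := hηk k hk
    have h3 := hbound k hk
    have h4 : 0 ≤ ν * (dt * ∑ n ∈ Finset.range k, ‖D ((1 / 2 : ℝ) • (ψ (n + 1) + ψ n))‖ ^ 2) :=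
      mul_nonneg hν.le (mul_nonneg hdt0.le (Finset.sum_nonneg fun _ _ => sq_nonneg _))
    linarith
  -- Used with `B' = 0` for the maximum, which involves no gradient error, and with `B' = B` for the
  -- energy norm. In the constant, `6 T` pays for the gradient of `η`, `2` for the L² norm of `ψ`
  -- and `2 / ν` for its gradient.
  have hC : ∀ B' : ℝ, 0 ≤ B' → (8 + 12 * T ^ 2) * A + 6 * T * B' + (2 + 2 / ν) * Z
      ≤ romConst ν T P * (A + B' + p + dt ^ 4 * I) := by
    intro B' hB'
    have h1 : romConst ν T P * (A + B' + p + dt ^ 4 * I)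
        = (8 + 12 * T ^ 2) * A + 6 * T * B' + (2 + 2 / ν) * Z
          + ((8 + 12 * T ^ 2) * (B' + p + dt ^ 4 * I) + 6 * T * (A + p + dt ^ 4 * I)
            + (2 + 2 / ν) * (1 + P / ν * (6 * T + 1)) * B') := by
      rw [hZ, romConst]
      ring
    rw [h1]
    have : 0 ≤ (8 + 12 * T ^ 2) * (B' + p + dt ^ 4 * I) + 6 * T * (A + p + dt ^ 4 * I)
            + (2 + 2 / ν) * (1 + P / ν * (6 * T + 1)) * B' := by positivity
    linarith
  constructor
  · intro k hk
    have h1 := hmax k hk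
    have h2 := hC 0 le_rfl
    have h3 : 0 ≤ 2 / ν * Z := by positivity
    simp only [mul_zero, add_zero] at h2
    linarith
  · have h1 := hmax N le_rfl
    have h2 : dt * ∑ n ∈ Finset.range N,
        ‖D ((1 / 2 : ℝ) • ((u (n + 1) - ur (n + 1)) + (u n - ur n)))‖ ^ 2
        ≤ 2 * (dt * B₁)
          + 2 * (dt * ∑ n ∈ Finset.range N, ‖D ((1 / 2 : ℝ) • (ψ (n + 1) + ψ n))‖ ^ 2) := by
      have h3 : ∀ n ∈ Finset.range N,
          ‖D ((1 / 2 : ℝ) • ((u (n + 1) - ur (n + 1)) + (u n - ur n)))‖ ^ 2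
          ≤ (‖D (η (n + 1))‖ ^ 2 + ‖D (η n)‖ ^ 2)
            + 2 * ‖D ((1 / 2 : ℝ) • (ψ (n + 1) + ψ n))‖ ^ 2 := by
        intro n _
        have h4 : D ((1 / 2 : ℝ) • ((u (n + 1) - ur (n + 1)) + (u n - ur n)))
            = (1 / 2 : ℝ) • (D (η (n + 1)) + D (η n))
              - D ((1 / 2 : ℝ) • (ψ (n + 1) + ψ n)) := by
          rw [hek, hek]
          simp only [map_smul, map_sub, map_add]
          module
        rw [h4]
        have h5 := norm_sub_sq_le_two ((1 / 2 : ℝ) • (D (η (n + 1)) + D (η n)))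
          (D ((1 / 2 : ℝ) • (ψ (n + 1) + ψ n)))
        have h6 := norm_add_sq_le_two (D (η (n + 1))) (D (η n))
        rw [norm_smul, mul_pow, Real.norm_eq_abs, sq_abs] at h5
        linarith
      have h7 := Finset.sum_le_sum h3
      rw [Finset.sum_add_distrib, Finset.sum_add_distrib, ← Finset.mul_sum] at h7
      have h8 : ∑ n ∈ Finset.range N, ‖D (η n)‖ ^ 2 ≤ B₁ :=
        Finset.sum_le_sum_of_subset_of_nonneg (Finset.range_mono (by omega))
          fun _ _ _ => sq_nonneg _
      have h9 : ∑ n ∈ Finset.range N, ‖D (η (n + 1))‖ ^ 2 ≤ B₁ := by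
        simp only [B₁]
        rw [Finset.sum_range_succ']
        linarith [sq_nonneg ‖D (η 0)‖]
      have h10 := mul_le_mul_of_nonneg_left
        (h7.trans (add_le_add_left (add_le_add h9 h8) _)) hdt0.le
      linarith
    have h3 := hscale hB0 (X := B₁) (by linarith)
    have h4 : dt * ∑ n ∈ Finset.range N, ‖D ((1 / 2 : ℝ) • (ψ (n + 1) + ψ n))‖ ^ 2 ≤ Z / ν := by
      rw [le_div_iff₀ hν]
      have h5 := hbound N le_rfl
      linarith [sq_nonneg ‖J (ψ N)‖]
    have h5 := hC B hB0
    have h6 : (2 + 2 / ν) * Z = 2 * Z + 2 * (Z / ν) := by ring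
    linarith

end DiscreteEstimates

/-! ### Ritz projection of the POD data and modes -/

section RitzModes

variable {d : ℕ} {Ω : Set (EuclideanSpace ℝ (Fin d))}
variable {F : Type*} [NormedAddCommGroup F] [InnerProductSpace ℝ F]
variable {H H' : Type*} [NormedAddCommGroup H] [InnerProductSpace ℝ H] [NormedAddCommGroup H']
  [InnerProductSpace ℝ H']

instance finiteDimensional_podSpace {V : Type*} [AddCommGroup V] [Module ℝ V] {M : ℕ}
    (φ : Fin M → V) (r : ℕ) : FiniteDimensional ℝ (podSpace φ r) :=
  FiniteDimensional.span_of_finite ℝ (Set.toFinite _)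

theorem podMode_mem_podSpace {V : Type*} [AddCommGroup V] [Module ℝ V] {M : ℕ}
    (φ : Fin M → V) {r : ℕ} {i : Fin M} (hi : i.val < r) : φ i ∈ podSpace φ r :=
  Submodule.subset_span ⟨i, hi, rfl⟩

theorem ritz_eq_self (hinj : Function.Injective (grad (Ω := Ω) (F := F)))
    {Y : Submodule ℝ (H01 Ω F)} [FiniteDimensional ℝ Y] {w : H01 Ω F} (hw : w ∈ Y) :
    ritz Y w = w :=
  (isRitz_ritz Y w).unique hinj ⟨hw, fun v _ => by rw [sub_self, map_zero, inner_zero_left]⟩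

theorem ritz_eq_zero (hinj : Function.Injective (grad (Ω := Ω) (F := F)))
    {Y : Submodule ℝ (H01 Ω F)} [FiniteDimensional ℝ Y] {w : H01 Ω F}
    (hw : ∀ v ∈ Y, inner ℝ (grad w) (grad v) = (0 : ℝ)) : ritz Y w = 0 :=
  (isRitz_ritz Y w).unique hinj ⟨Y.zero_mem, fun v hv => by rw [sub_zero]; exact hw v hv⟩

variable {M : ℕ} {v : Fin M → H01 Ω F} {lam : Fin M → ℝ} {z : Fin M → EuclideanSpace ℝ (Fin M)}

/-- The error of the Ritz projection of the data on the span of the first `r` modes. -/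
theorem IsPOD.sum_ritz_error {A : H01 Ω F →ₗ[ℝ] H}
    (h : IsPOD (fun x y => inner ℝ (A x) (A y)) v lam z) (hA : Function.Injective A) (hM : 0 < M)
    (hinj : Function.Injective (grad (Ω := Ω) (F := F))) (L : H01 Ω F →ₗ[ℝ] H') (r : ℕ) :
    ∑ m, ‖L (v m - ritz (podSpace (podMode v lam z) r) (v m))‖ ^ 2
      = M * ∑ i ∈ truncated lam r, lam i * ‖L (podMode v lam z i
          - ritz (podSpace (podMode v lam z) r) (podMode v lam z i))‖ ^ 2 :=
  h.projection_error hA hM L (ritzLM hinj (podSpace (podMode v lam z) r)) fun _ hi =>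
    ritz_eq_self hinj (podMode_mem_podSpace _ hi)

/-- For an `H¹₀` POD basis the Ritz projection annihilates the truncated modes. -/
theorem IsPOD.ritz_podMode_eq_zero (h : IsPOD formH1 v lam z) (hM : 0 < M)
    (hinj : Function.Injective (grad (Ω := Ω) (F := F))) {r : ℕ} {i : Fin M} (hi : r ≤ i.val) :
    ritz (podSpace (podMode v lam z) r) (podMode v lam z i) = 0 := by
  refine ritz_eq_zero hinj fun w hw => ?_
  induction hw using Submodule.span_induction with
  | mem x hx =>
    obtain ⟨j, hj, rfl⟩ := hx
    have hj' : j.val < r := hj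
    exact IsPOD.inner_podMode_eq_zero
      (A := (grad : H01 Ω F →L[ℝ] Grad Ω F).toLinearMap) h hM (fun hij => by subst hij; omega)
  | zero => rw [map_zero, inner_zero_right]
  | add x y _ _ hx hy => rw [map_add, inner_add_right, hx, hy, add_zero]
  | smul c x _ hx => rw [map_smul, real_inner_smul_right, hx, mul_zero]

end RitzModes

/-! ### From discrete estimates to the heat equation -/

section ErrorBound

variable {d : ℕ} {Ω : Set (EuclideanSpace ℝ (Fin d))}

theorem integral_sq_le_regConst {F : Type*} [NormedAddCommGroup F] {T : ℝ} (u₃ q f₂ : ℝ → L2 Ω F) :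
    ∫ t in Ioo 0 T, ‖u₃ t‖ ^ 2 ≤ regConst T u₃ q f₂ := by
  have h1 : 0 ≤ ∫ t in Ioo 0 T, ‖q t‖ ^ 2 := integral_nonneg fun _ => sq_nonneg _
  have h2 : 0 ≤ ∫ t in Ioo 0 T, ‖f₂ t‖ ^ 2 := integral_nonneg fun _ => sq_nonneg _
  unfold regConst
  linarith

theorem sum_integral_grid {T : ℝ} {N : ℕ} (hN : 0 < N) (hT : 0 < T) {dt : ℝ} (hdt : dt = T / N)
    {g : ℝ → ℝ} (hg : Integrable g (volume.restrict (Ioo 0 T))) :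
    ∑ n ∈ Finset.range N, ∫ t in ((n : ℝ) * dt)..(((n + 1 : ℕ) : ℝ) * dt), g t
      = ∫ t in Ioo 0 T, g t := by
  have hN' : (0 : ℝ) < N := by positivity
  have hNdt : (N : ℝ) * dt = T := by rw [hdt]; field_simp
  have hdt0 : 0 < dt := by rw [hdt]; positivity
  have hgI : IntervalIntegrable g volume 0 T :=
    (intervalIntegrable_iff_integrableOn_Ioo_of_le hT.le).2 hg
  have h := intervalIntegral.sum_integral_adjacent_intervals (a := fun n : ℕ => (n : ℝ) * dt)
    (n := N) (f := g) (μ := volume) fun n hn => by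
      refine hgI.mono_set ?_
      have h1 : (n : ℝ) * dt ≤ ((n + 1 : ℕ) : ℝ) * dt := by
        push_cast
        nlinarith
      have h2 : ((n + 1 : ℕ) : ℝ) * dt ≤ T := by
        rw [← hNdt]
        have : ((n + 1 : ℕ) : ℝ) ≤ N := by exact_mod_cast hn
        gcongr
      rw [uIcc_of_le h1, uIcc_of_le hT.le]
      exact Icc_subset_Icc (by positivity) h2
  rw [h]
  simp only [Nat.cast_zero, zero_mul, hNdt]
  rw [intervalIntegral.integral_of_le hT.le, integral_Ioc_eq_integral_Ioo]

variable {F : Type*} [NormedAddCommGroup F] [InnerProductSpace ℝ F]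

/-- The error bound in terms of the Ritz projection errors of the data. -/
theorem rom_error_le [CompleteSpace F] (hd : 0 < d) (hΩ : IsOpen Ω) (hΩb : Bornology.IsBounded Ω)
    {ν T P : ℝ} (hν : 0 < ν) (hT : 0 < T) (hP : 0 < P)
    (hpoin : ∀ w : H01 Ω F, ‖fn w‖ ^ 2 ≤ P * ‖grad w‖ ^ 2)
    {f f₁ f₂ : ℝ → L2 Ω F} {u : ℝ → H01 Ω F} {u₁ u₂ u₃ q : ℝ → L2 Ω F}
    (hu : IsWeakSolution ν T f u u₁) (hreg : RegularityCondition T u₁ u₂ u₃ q f f₁ f₂)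
    {N : ℕ} (hN : 0 < N) {dt : ℝ} (hdt : dt = T / N)
    {Y : Submodule ℝ (H01 Ω F)} [FiniteDimensional ℝ Y]
    {ur : ℕ → H01 Ω F} (hur : IsCNROM ν dt N f Y ur) {A B : ℝ}
    (hA : ∑ m, ‖fn (dqData N dt (fun n => u (n * dt)) m
      - ritz Y (dqData N dt (fun n => u (n * dt)) m))‖ ^ 2 = ((2 * N + 1 : ℕ) : ℝ) * A)
    (hB : ∑ m, ‖grad (dqData N dt (fun n => u (n * dt)) m
      - ritz Y (dqData N dt (fun n => u (n * dt)) m))‖ ^ 2 = ((2 * N + 1 : ℕ) : ℝ) * B) :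
    (∀ k ≤ N, ‖fn (u (k * dt) - ur k)‖ ^ 2 ≤ romConst ν T P *
      (A + ‖fn (ur 0 - ritz Y (u 0))‖ ^ 2 + dt ^ 4 * regConst T u₃ q f₂)) ∧
    energyError dt N (fun n : ℕ => u (n * dt) - ur n) ≤ romConst ν T P *
      (A + B + ‖fn (ur 0 - ritz Y (u 0))‖ ^ 2 + dt ^ 4 * regConst T u₃ q f₂) := by
  have hinj := grad_injective (Ω := Ω) (F := F) hd hΩb
  have hN' : (0 : ℝ) < N := by positivity
  have hNdt : (N : ℝ) * dt = T := by rw [hdt]; field_simp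
  have hdt0 : 0 < dt := by rw [hdt]; positivity
  obtain ⟨U, hUc, hU, htr⟩ := exists_continuous_deriv_trapezoid hT hu.continuousOn hu.timeDeriv
    hreg.deriv_u₁ hreg.deriv_u₂
  have hweak := hu.weakForm_everywhere hd hΩ hΩb hν hT hreg.continuousOn_f hUc hU
  have hgrid : ∀ n ≤ N, (n : ℝ) * dt ∈ Icc 0 T := fun n hn => by
    refine ⟨by positivity, ?_⟩
    rw [← hNdt]
    have : (n : ℝ) ≤ N := by exact_mod_cast hn
    gcongr
  have hsum := sum_integral_grid hN hT hdt
    (hreg.deriv_u₂.2.1.integrable_norm_pow (by norm_num) : Integrable (fun t => ‖u₃ t‖ ^ 2) _)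
  have hI := integral_sq_le_regConst (T := T) u₃ q f₂
  have hI0 : 0 ≤ ∫ t in Ioo 0 T, ‖u₃ t‖ ^ 2 := integral_nonneg fun _ => sq_nonneg _
  have key := crankNicolson_error_le (J := (fn : H01 Ω F →L[ℝ] L2 Ω F).toLinearMap)
    (D := (grad : H01 Ω F →L[ℝ] Grad Ω F).toLinearMap) (R := ritzLM hinj Y) (Y := Y)
    (u := fun n : ℕ => u (n * dt)) (ur := ur) (U := fun n : ℕ => U (n * dt))
    (f := fun n : ℕ => f (n * dt)) (A := A) (B := B) (I := regConst T u₃ q f₂)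
    hν hT hP hN hdt hpoin (fun w => (isRitz_ritz Y w).1) (fun w => (isRitz_ritz Y w).2)
    (fun n hn => hweak _ (hgrid n hn)) hur.mem hur.scheme (hsum.le.trans hI)
    (fun n hn => by
      have h1 := htr _ _ (hgrid n (by omega)).1 (by push_cast; nlinarith)
        (hgrid (n + 1) (by omega)).2
      have h2 : ((n + 1 : ℕ) : ℝ) * dt - n * dt = dt := by push_cast; ring
      rw [h2] at h1
      exact h1) hA hB (hI0.trans hI)
  have h0 : ((0 : ℕ) : ℝ) * dt = 0 := by simp
  simp only [h0] at key
  exact key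

end ErrorBound

end PODHeat

/-! ### The two choices of POD basis -/

theorem mainTheorem3 {d : ℕ} (hd : 0 < d)
    (Ω : Set (EuclideanSpace ℝ (Fin d))) (hΩ : IsOpen Ω) (hΩb : Bornology.IsBounded Ω)
    {F : Type*} [NormedAddCommGroup F] [InnerProductSpace ℝ F] [FiniteDimensional ℝ F]
    (ν : ℝ) (hν : 0 < ν) (T : ℝ) (hT : 0 < T) :
    ∃ C : ℝ, 0 < C ∧
      -- the data: forcing, weak solution, and the derivatives in the regularity condition
      ∀ (f f₁ f₂ : ℝ → L2 Ω F) (u : ℝ → H01 Ω F) (u₁ u₂ u₃ q : ℝ → L2 Ω F),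
        IsWeakSolution ν T f u u₁ → RegularityCondition T u₁ u₂ u₃ q f f₁ f₂ →
      -- the time grid and the snapshots with their difference quotients
      ∀ (N : ℕ), 0 < N → ∀ (dt : ℝ), dt = T / N →
      ∀ (v : Fin (2 * N + 1) → H01 Ω F), v = dqData N dt (fun n => u (n * dt)) →
      -- eigenpairs of the correlation matrix, modes, ROM dimension, ROM space
      ∀ (lam : Fin (2 * N + 1) → ℝ)
        (z : Fin (2 * N + 1) → EuclideanSpace ℝ (Fin (2 * N + 1)))
        (φ : Fin (2 * N + 1) → H01 Ω F), φ = podMode v lam z →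
      ∀ (r : ℕ), r ≤ podRank lam →
      ∀ (Y : Submodule ℝ (H01 Ω F)), Y = podSpace φ r →
      -- the ROM solution, its error, and the discrete initial error
      ∀ (ur : ℕ → H01 Ω F), IsCNROM ν dt N f Y ur →
      ∀ (e : ℕ → H01 Ω F), e = (fun n : ℕ => u (n * dt) - ur n) →
      ∀ (φr0 : H01 Ω F), φr0 = ur 0 - ritz Y (u 0) →
        (IsPOD formL2 v lam z →
          (∀ k : ℕ, 1 ≤ k → k ≤ N →
            ‖fn (e k)‖ ^ 2 ≤ C *
              ((∑ i ∈ truncated lam r, lam i * ‖fn (φ i - ritz Y (φ i))‖ ^ 2)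
                + ‖fn φr0‖ ^ 2 + dt ^ 4 * regConst T u₃ q f₂)) ∧
          energyError dt N e ≤ C *
            ((∑ i ∈ truncated lam r, lam i *
                (‖fn (φ i - ritz Y (φ i))‖ ^ 2 + ‖grad (φ i - ritz Y (φ i))‖ ^ 2))
              + ‖fn φr0‖ ^ 2 + dt ^ 4 * regConst T u₃ q f₂)) ∧
        (IsPOD formH1 v lam z →
          (∀ k : ℕ, 1 ≤ k → k ≤ N →
            ‖fn (e k)‖ ^ 2 ≤ C *
              ((∑ i ∈ truncated lam r, lam i * ‖fn (φ i)‖ ^ 2)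
                + ‖fn φr0‖ ^ 2 + dt ^ 4 * regConst T u₃ q f₂)) ∧
          energyError dt N e ≤ C *
            ((∑ i ∈ truncated lam r, (1 + ‖fn (φ i)‖ ^ 2) * lam i)
              + ‖fn φr0‖ ^ 2 + dt ^ 4 * regConst T u₃ q f₂)) := by
  have : CompleteSpace F := FiniteDimensional.complete ℝ F
  obtain ⟨P, hP, hpoin⟩ := exists_poincare (Ω := Ω) (F := F) hd hΩb
  refine ⟨romConst ν T P, romConst_pos hν hT hP, ?_⟩
  intro f f₁ f₂ u u₁ u₂ u₃ q hu hreg N hN dt hdt v hv lam z φ hφ r _ Y hY ur hur e he φr0 hφr0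
  have hinj := grad_injective (Ω := Ω) (F := F) hd hΩb
  have hM : 0 < 2 * N + 1 := by omega
  subst hφ hY he hφr0
  constructor
  · intro hpod
    have hA := IsPOD.sum_ritz_error (A := (fn : H01 Ω F →L[ℝ] L2 Ω F).toLinearMap) hpod
      (fn_injective hΩ) hM hinj (fn : H01 Ω F →L[ℝ] L2 Ω F).toLinearMap r
    have hB := IsPOD.sum_ritz_error (A := (fn : H01 Ω F →L[ℝ] L2 Ω F).toLinearMap) hpod
      (fn_injective hΩ) hM hinj (grad : H01 Ω F →L[ℝ] Grad Ω F).toLinearMap r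
    subst hv
    obtain ⟨h1, h2⟩ := rom_error_le hd hΩ hΩb hν hT hP hpoin hu hreg hN hdt hur hA hB
    refine ⟨fun k _ hk => h1 k hk, ?_⟩
    simp only [mul_add (lam _), Finset.sum_add_distrib]
    exact h2
  · intro hpod
    have hA := IsPOD.sum_ritz_error (A := (grad : H01 Ω F →L[ℝ] Grad Ω F).toLinearMap) hpod
      hinj hM hinj (fn : H01 Ω F →L[ℝ] L2 Ω F).toLinearMap r
    have hB := IsPOD.sum_ritz_error (A := (grad : H01 Ω F →L[ℝ] Grad Ω F).toLinearMap) hpod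
      hinj hM hinj (grad : H01 Ω F →L[ℝ] Grad Ω F).toLinearMap r
    -- Truncated modes are H¹₀-orthogonal to the reduced space, so their projection error is the
    -- mode itself; by `hone` its gradient contributes just the eigenvalue.
    have hsub : ∀ i ∈ truncated lam r, podMode v lam z i
        - ritz (podSpace (podMode v lam z) r) (podMode v lam z i) = podMode v lam z i :=
      fun i hi => by
        rw [hpod.ritz_podMode_eq_zero hM hinj (Finset.mem_filter.1 hi).2.1, sub_zero]
    have hone : ∀ i ∈ truncated lam r, ‖grad (podMode v lam z i)‖ ^ 2 = 1 := fun i hi =>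
      IsPOD.norm_podMode (A := (grad : H01 Ω F →L[ℝ] Grad Ω F).toLinearMap) hpod hM
        ((lt_podRank_iff hpod.antitone i).1 (Finset.mem_filter.1 hi).2.2)
    subst hv
    obtain ⟨h1, h2⟩ := rom_error_le hd hΩ hΩb hν hT hP hpoin hu hreg hN hdt hur hA hB
    have e1 : ∑ i ∈ truncated lam r, lam i * ‖fn (podMode _ lam z i
          - ritz (podSpace (podMode _ lam z) r) (podMode _ lam z i))‖ ^ 2
        = ∑ i ∈ truncated lam r, lam i * ‖fn (podMode _ lam z i)‖ ^ 2 :=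
      Finset.sum_congr rfl fun i hi => by rw [hsub i hi]
    have e2 : ∑ i ∈ truncated lam r, lam i * ‖grad (podMode _ lam z i
          - ritz (podSpace (podMode _ lam z) r) (podMode _ lam z i))‖ ^ 2
        = ∑ i ∈ truncated lam r, lam i :=
      Finset.sum_congr rfl fun i hi => by rw [hsub i hi, hone i hi, mul_one]
    have e3 : ∀ w : Fin (2 * N + 1) → H01 Ω F,
        ∑ i ∈ truncated lam r, (1 + ‖fn (w i)‖ ^ 2) * lam i
        = ∑ i ∈ truncated lam r, lam i * ‖fn (w i)‖ ^ 2 + ∑ i ∈ truncated lam r, lam i :=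
      fun w => by
        rw [← Finset.sum_add_distrib]
        exact Finset.sum_congr rfl fun i _ => by ring
    constructor
    · intro k _ hk
      rw [← e1]
      exact h1 k hk
    · rw [e3, ← e1, ← e2]
      exact h2
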